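/- Let $(M,\langle\,,\rangle)$ be a connected pseudo-Riemannian weakly symmetric manifold: a connected (Hausdorff, second countable) smooth manifold with a smooth nondegenerate symmetric bilinear form $\langle\,,\rangle_x$ on every tangent space $T_xM$, such that for every $x\in M$ and every nonzero $\xi\in T_xM$ there is an isometry $\phi$ of $M$ with $\phi(x)=x$ and $d\phi(\xi)=-\xi$. Let $G=I(M)^0$ be the identity component of the isometry group of $M$ (a Lie group in the compact-open topology), $\mathfrak g$ its Lie algebra, $\mathfrak n$ the nilradical (largest nilpotent ideal) of $\mathfrak g$, and $N$ the nilradical of $G$, that is, the connected subgroup of $G$ with Lie algebra $\mathfrak n$. Let $p\in M$, let $H=\{h\in G: h(p)=p\}$, and let $\mathfrak h$ be the Lie algebra of $H$. Suppose that there is a reductive decomposition $\mathfrak g=\mathfrak m+\mathfrak h$, that is, a linear subspace $\mathfrak m\subset\mathfrak g$ with $\mathfrak g=\mathfrak m\oplus\mathfrak h$ and $\mathrm{Ad}(H)\mathfrak m\subset\mathfrak m$, such that $\mathfrak n\subset\mathfrak m$ and such that the restriction to $[\mathfrak n,\mathfrak n]$ of the scalar product on $\mathfrak m$ is positive definite or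 negative definite. Here the scalar product on $\mathfrak m$ is $\langle\,,\rangle_p$, transported by the isomorphism $\mathfrak m\cong T_pM$, $X\mapsto \frac{d}{dt}\big|_{t=0}\exp(tX)(p)$. Then $N$ is at most $2$-step nilpotent, i.e. $N$ is a nilpotent group of class at most $2$. -/

import Mathlib

open scoped Manifold ContDiff Bundle

noncomputable section

namespace WeaklySymmetric

variable {n : ℕ} {M : Type*} [TopologicalSpace M] [ChartedSpace (EuclideanSpace ℝ (Fin n)) M]
  [IsManifold (𝓡 n) ∞ M]

/-! ### The Lie algebra of smooth vector fields -/

variable (n M) in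
/-- Smooth vector fields on `M`: smooth sections of the tangent bundle, with their pointwise
real vector space structure. -/
abbrev SmoothVectorField : Type _ :=
  ContMDiffSection (𝓡 n) (EuclideanSpace ℝ (Fin n)) ∞ (TangentSpace (𝓡 n) : M → Type _)

instance isManifold_minSmoothness : IsManifold (𝓡 n) (minSmoothness ℝ 3) M := by
  rw [minSmoothness_of_isRCLikeNormedField]
  infer_instance

theorem SmoothVectorField.mdifferentiableAt (X : SmoothVectorField n M) (x : M) :
    MDifferentiableAt (𝓡 n) ((𝓡 n).prod 𝓘(ℝ, EuclideanSpace ℝ (Fin n)))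
      (fun y ↦ (⟨y, X y⟩ : TangentBundle (𝓡 n) M)) x :=
  (X.contMDiff x).mdifferentiableAt (by simp)

/-- The Lie bracket of vector fields. -/
instance : Bracket (SmoothVectorField n M) (SmoothVectorField n M) where
  bracket X Y :=
    ⟨VectorField.mlieBracket (𝓡 n) X Y, fun x ↦ by
      have : IsManifold (𝓡 n) (((⊤ : ℕ∞) : WithTop ℕ∞) + 1) M := by simpa
      exact ContMDiffAt.mlieBracket_vectorField (m := ⊤) (n := ⊤)
        (X.contMDiff x) (Y.contMDiff x)
        (by rw [minSmoothness_of_isRCLikeNormedField]; simp)⟩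

theorem SmoothVectorField.lie_apply (X Y : SmoothVectorField n M) (x : M) :
    ⁅X, Y⁆ x = VectorField.mlieBracket (𝓡 n) X Y x := rfl

instance : LieRing (SmoothVectorField n M) where
  add_lie X Y Z := by
    ext1 x
    exact VectorField.mlieBracket_add_left (X.mdifferentiableAt x) (Y.mdifferentiableAt x)
  lie_add X Y Z := by
    ext1 x
    exact VectorField.mlieBracket_add_right (Y.mdifferentiableAt x) (Z.mdifferentiableAt x)
  lie_self X := by
    ext1 x
    simp [SmoothVectorField.lie_apply]
  leibniz_lie X Y Z := by
    ext1 x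
    have h : minSmoothness ℝ 2 ≤ ∞ := by
      rw [minSmoothness_of_isRCLikeNormedField]; exact WithTop.coe_le_coe.2 (le_top : (2 : ℕ∞) ≤ ⊤)
    exact VectorField.leibniz_identity_mlieBracket_apply
      ((X.contMDiff x).of_le h) ((Y.contMDiff x).of_le h) ((Z.contMDiff x).of_le h)

instance : LieAlgebra ℝ (SmoothVectorField n M) where
  lie_smul c X Y := by
    ext1 x
    exact VectorField.mlieBracket_const_smul_right (Y.mdifferentiableAt x)

/-! ### Pseudo-Riemannian metrics and isometries -/

variable (n M) in
/-- A pseudo-Riemannian metric: a smooth family of nondegenerate symmetric bilinear forms on the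
tangent spaces. -/
structure PseudoRiemannianMetric where
  /-- the scalar product on `T_x M` -/
  inner (x : M) : TangentSpace (𝓡 n) x →L[ℝ] TangentSpace (𝓡 n) x →L[ℝ] ℝ
  symm (x : M) (v w : TangentSpace (𝓡 n) x) : inner x v w = inner x w v
  nondegenerate (x : M) (v : TangentSpace (𝓡 n) x) : (∀ w, inner x v w = 0) → v = 0
  contMDiff : ContMDiff (𝓡 n)
    ((𝓡 n).prod 𝓘(ℝ, EuclideanSpace ℝ (Fin n) →L[ℝ] EuclideanSpace ℝ (Fin n) →L[ℝ] ℝ)) ∞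
    (fun x ↦ Bundle.TotalSpace.mk'
      (EuclideanSpace ℝ (Fin n) →L[ℝ] EuclideanSpace ℝ (Fin n) →L[ℝ] ℝ) x (inner x))

/-- The isometries of `(M, g)`: diffeomorphisms of `M` whose differentials preserve `g`. -/
@[ext]
structure Isom (g : PseudoRiemannianMetric n M) where
  /-- the underlying diffeomorphism -/
  toDiffeo : M ≃ₘ⟮𝓡 n, 𝓡 n⟯ M
  isometric (x : M) (v w : TangentSpace (𝓡 n) x) :
    g.inner (toDiffeo x) (mfderiv (𝓡 n) (𝓡 n) toDiffeo x v)
      (mfderiv (𝓡 n) (𝓡 n) toDiffeo x w) = g.inner x v w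

namespace Isom

variable {g : PseudoRiemannianMetric n M}

instance : CoeFun (Isom g) (fun _ ↦ M → M) := ⟨fun φ ↦ φ.toDiffeo⟩

/-- The group structure is composition. -/
instance : Mul (Isom g) where
  mul φ ψ := ⟨ψ.toDiffeo.trans φ.toDiffeo, fun x v w ↦ by
    have h : mfderiv (𝓡 n) (𝓡 n) (ψ.toDiffeo.trans φ.toDiffeo) x
        = (mfderiv (𝓡 n) (𝓡 n) φ.toDiffeo (ψ.toDiffeo x)).comp
          (mfderiv (𝓡 n) (𝓡 n) ψ.toDiffeo x) :=
      mfderiv_comp x (φ.toDiffeo.mdifferentiable (by simp) _)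
        (ψ.toDiffeo.mdifferentiable (by simp) _)
    rw [h]
    exact (φ.isometric (ψ x) _ _).trans (ψ.isometric x v w)⟩

instance : One (Isom g) where
  one := ⟨Diffeomorph.refl (𝓡 n) M ∞, fun x v w ↦ by
    have h : mfderiv (𝓡 n) (𝓡 n) (Diffeomorph.refl (𝓡 n) M ∞) x
        = ContinuousLinearMap.id ℝ (TangentSpace (𝓡 n) x) := mfderiv_id
    rw [h]
    rfl⟩

instance : Inv (Isom g) where
  inv φ := ⟨φ.toDiffeo.symm, fun x v w ↦ by
    have h : (mfderiv (𝓡 n) (𝓡 n) φ.toDiffeo (φ.toDiffeo.symm x)).comp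
        (mfderiv (𝓡 n) (𝓡 n) φ.toDiffeo.symm x)
        = ContinuousLinearMap.id ℝ (TangentSpace (𝓡 n) x) := by
      have h₁ := mfderiv_comp x (φ.toDiffeo.mdifferentiable (by simp) (φ.toDiffeo.symm x))
        (φ.toDiffeo.symm.mdifferentiable (by simp) x)
      have h₂ : φ.toDiffeo ∘ φ.toDiffeo.symm = id := by
        ext y; simp
      rw [h₂, mfderiv_id] at h₁
      exact h₁.symm
    have hv := DFunLike.congr_fun h v
    have hw := DFunLike.congr_fun h w
    have key := φ.isometric (φ.toDiffeo.symm x) (mfderiv (𝓡 n) (𝓡 n) φ.toDiffeo.symm x v)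
      (mfderiv (𝓡 n) (𝓡 n) φ.toDiffeo.symm x w)
    rw [← key]
    have e : φ.toDiffeo (φ.toDiffeo.symm x) = x := by simp
    have aux : ∀ (y z : M), y = z → ∀ a b : EuclideanSpace ℝ (Fin n),
        g.inner y a b = g.inner z a b := by
      rintro y _ rfl a b
      rfl
    erw [hv, hw]
    exact aux _ _ e v w⟩

theorem ext_apply {φ ψ : Isom g} (h : ∀ x, φ x = ψ x) : φ = ψ :=
  Isom.ext (Diffeomorph.ext h)

theorem mul_apply (φ ψ : Isom g) (x : M) : (φ * ψ) x = φ (ψ x) := rfl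

theorem one_apply (x : M) : (1 : Isom g) x = x := rfl

theorem inv_apply_self (φ : Isom g) (x : M) : φ⁻¹ (φ x) = x := φ.toDiffeo.symm_apply_apply x

/-- The isometry group `I(M)`. -/
instance : Group (Isom g) where
  mul_assoc _ _ _ := rfl
  one_mul _ := rfl
  mul_one _ := rfl
  inv_mul_cancel φ := ext_apply fun x ↦ φ.inv_apply_self x

/-- An isometry as a continuous map. -/
def toContinuousMap (φ : Isom g) : C(M, M) := ⟨φ, φ.toDiffeo.continuous⟩

/-- The compact-open topology on `I(M)`. -/
instance : TopologicalSpace (Isom g) := TopologicalSpace.induced toContinuousMap inferInstance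

theorem continuous_mul_left (φ : Isom g) : Continuous (fun ψ : Isom g ↦ φ * ψ) :=
  continuous_induced_rng.2 <| by
    have h : Continuous (toContinuousMap : Isom g → C(M, M)) := continuous_induced_dom
    exact (ContinuousMap.continuous_postcomp φ.toContinuousMap).comp h

/-- Left translation by `φ` carries the component of `ψ` onto the component of `φ * ψ`. -/
theorem mul_mem_connectedComponent (φ : Isom g) {ψ χ : Isom g}
    (h : χ ∈ connectedComponent ψ) : φ * χ ∈ connectedComponent (φ * ψ) :=
  (continuous_mul_left φ).image_connectedComponent_subset ψ ⟨χ, h, rfl⟩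

end Isom

variable (g : PseudoRiemannianMetric n M)

/-- `I(M)⁰`: the identity component of the isometry group for the compact-open topology. -/
def identityComponent : Subgroup (Isom g) where
  carrier := connectedComponent 1
  one_mem' := mem_connectedComponent
  mul_mem' {φ ψ} hφ hψ := by
    have h := Isom.mul_mem_connectedComponent φ hψ
    rw [mul_one] at h
    rwa [connectedComponent_eq hφ]
  inv_mem' {φ} hφ := by
    have h := Isom.mul_mem_connectedComponent φ⁻¹
      (show (1 : Isom g) ∈ connectedComponent φ from
        connectedComponent_eq hφ ▸ mem_connectedComponent)
    rwa [mul_one, inv_mul_cancel] at h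

/-- The isotropy group `H` at `p` of the group `G = I(M)⁰`. -/
def isotropyGroup (p : M) : Subgroup (Isom g) where
  carrier := {φ | φ ∈ identityComponent g ∧ φ p = p}
  one_mem' := ⟨one_mem _, rfl⟩
  mul_mem' {φ ψ} hφ hψ := ⟨mul_mem hφ.1 hψ.1, by rw [Isom.mul_apply, hψ.2, hφ.2]⟩
  inv_mem' {φ} hφ := ⟨inv_mem hφ.1, by
    have h := Isom.inv_apply_self φ p
    rwa [hφ.2] at h⟩

/-- `(M, g)` is weakly symmetric: for every `x` and every nonzero `ξ ∈ T_x M` there is an isometry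
`φ` with `φ(x) = x` and `dφ(ξ) = -ξ` (the equation below holds in the tangent bundle, so it
contains `φ(x) = x`). -/
def IsWeaklySymmetric : Prop :=
  ∀ (x : M) (ξ : TangentSpace (𝓡 n) x), ξ ≠ 0 → ∃ φ : Isom g,
    tangentMap (𝓡 n) (𝓡 n) φ ⟨x, ξ⟩ = (⟨x, -ξ⟩ : TangentBundle (𝓡 n) M)

/-! ### One-parameter groups, Lie algebras and connected subgroups -/

variable {g}

/-- `c` is a (smooth) one-parameter group of isometries with velocity field `X`, that is,
`c t = exp (t X)`: the action `(t, x) ↦ c t x` is smooth and its orbits are the integral curves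
of `X`. -/
def IsOneParameterGroup (c : Multiplicative ℝ →* Isom g) (X : SmoothVectorField n M) : Prop :=
  ContMDiff (𝓘(ℝ, ℝ).prod (𝓡 n)) (𝓡 n) ∞
      (fun q : ℝ × M ↦ c (Multiplicative.ofAdd q.1) q.2) ∧
    ∀ x : M, IsMIntegralCurve (I := 𝓡 n) (fun t : ℝ ↦ c (Multiplicative.ofAdd t) x) X

/-- The Lie algebra of a closed subgroup `K` of `I(M)`: it consists of its one-parameter subgroups,
each given by its velocity field on `M`, with the operations of vector fields. (These fields
already form a Lie algebra, so that taking the Lie subalgebra they generate adds nothing. The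
bracket of vector fields is minus the bracket of left invariant fields on the group; `X ↦ -X`
identifies the two Lie algebras.) -/
def lieAlgebraOf (K : Subgroup (Isom g)) : LieSubalgebra ℝ (SmoothVectorField n M) :=
  LieSubalgebra.lieSpan ℝ (SmoothVectorField n M)
    {X | ∃ c : Multiplicative ℝ →* Isom g, IsOneParameterGroup c X ∧ ∀ t, c t ∈ K}

/-- The connected subgroup of `K` whose Lie algebra is the subalgebra `s` of the Lie algebra
of `K`: the subgroup generated by `exp s`. -/
def connectedSubgroup (K : Subgroup (Isom g)) (s : Set (SmoothVectorField n M)) :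
    Subgroup (Isom g) :=
  Subgroup.closure {φ | ∃ X ∈ s, ∃ c : Multiplicative ℝ →* Isom g,
    IsOneParameterGroup c X ∧ (∀ t, c t ∈ K) ∧ c (Multiplicative.ofAdd 1) = φ}

/-- The nilradical of a Lie algebra: the largest nilpotent ideal, i.e. the sum of all nilpotent
ideals. -/
def lieNilradical (L : Type*) [LieRing L] [LieAlgebra ℝ L] : LieIdeal ℝ L :=
  sSup {J : LieIdeal ℝ L | LieRing.IsNilpotent J}

variable (g)

/-- The Lie algebra `𝔤` of `G = I(M)⁰`. -/
abbrev isomLieAlgebra : LieSubalgebra ℝ (SmoothVectorField n M) :=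
  lieAlgebraOf (identityComponent g)

/-- The nilradical `𝔫` of `𝔤`, as an ideal of `𝔤`. -/
abbrev nilradicalAlgebra : LieIdeal ℝ (isomLieAlgebra g) := lieNilradical (isomLieAlgebra g)

/-- The nilradical `N` of `G = I(M)⁰`: the connected subgroup of `G` with Lie algebra `𝔫`. -/
def nilradicalGroup : Subgroup (Isom g) :=
  connectedSubgroup (identityComponent g)
    {X | ∃ Y ∈ nilradicalAlgebra g, (Y : SmoothVectorField n M) = X}

variable {g}

theorem mfderiv_isInvertible (φ : Isom g) (x : M) :
    (mfderiv (𝓡 n) (𝓡 n) φ x).IsInvertible :=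
  ⟨φ.toDiffeo.mfderivToContinuousLinearEquiv (by simp) x, rfl⟩

/-- `Ad(φ)`: the push-forward of vector fields by the isometry `φ`, i.e. the pull-back by `φ⁻¹`.
It carries the velocity field of `c` to the velocity field of `t ↦ φ * c t * φ⁻¹`. -/
def Ad (φ : Isom g) (X : SmoothVectorField n M) : SmoothVectorField n M :=
  ⟨VectorField.mpullback (𝓡 n) (𝓡 n) (φ⁻¹ : Isom g) X,
    ContMDiff.mpullback_vectorField (n := ∞) X.contMDiff φ⁻¹.toDiffeo.contMDiff
      (mfderiv_isInvertible φ⁻¹) (by simp)⟩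

variable (g)

/-- A reductive decomposition `𝔤 = 𝔪 + 𝔥` of the Lie algebra of `G = I(M)⁰`, where `𝔥` is the Lie
algebra of the isotropy group `H` at `p`: a direct sum of vector spaces with `Ad(H) 𝔪 ⊆ 𝔪`. -/
structure IsReductiveDecomposition (p : M) (m : Submodule ℝ (SmoothVectorField n M)) : Prop where
  sup_eq : m ⊔ (lieAlgebraOf (isotropyGroup g p)).toSubmodule = (isomLieAlgebra g).toSubmodule
  disjoint : Disjoint m (lieAlgebraOf (isotropyGroup g p)).toSubmodule
  ad_mem : ∀ φ ∈ isotropyGroup g p, ∀ X ∈ m, Ad φ X ∈ m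

end WeaklySymmetric

end

/-! ### Nilpotent ideals -/

/-! Write 𝔷 = [𝔫,𝔫]. The whole proof aims at [𝔫,𝔷] = 0.

Geometry (`inner_lie_eq_zero_of_orthogonal`). Take X ∈ 𝔷 and Y ∈ 𝔫 with Y_p ⟂ 𝔷_p. Weak symmetry
gives an isometry φ fixing p and reversing X_p + Y_p. `Ad φ` is an automorphism of 𝔤, so it
preserves 𝔫 and 𝔷, and it is isometric at p. Comparing components along 𝔷 and orthogonal to it,
definiteness forces Ad(φ)X = -X, while W = Ad(φ)Y + Y vanishes at p. The Killing field W acts skewly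
on T_pM, so comparing ⟨[X,Y],X⟩ at p with its image under φ yields ⟨[X,Y],X⟩ = -⟨[X,Y],X⟩ = 0.

Algebra (`lie_lie_lieNilradical_eq_bot`). Thus ad Y is skew on the definite space 𝔷; it is also
nilpotent, hence zero there. Splitting 𝔫 into 𝔷 and vectors orthogonal to 𝔷 gives [𝔫,𝔷] = [𝔷,𝔷] =
[𝔷,[𝔷,𝔷]], and nilpotency makes this vanish. Finite-dimensionality of 𝔤 is not needed: evaluation at
p is injective on 𝔷 by definiteness, so 𝔷 is finite-dimensional and lies in a single nilpotent ideal
by Fitting's theorem.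

Group (`nilpotencyClass_nilradicalGroup_le_two`). With triple brackets zero, the series for Ad(exp
X) on 𝔫 stops after its linear term. Commutators of exponentials then fix every Z ∈ 𝔫, and so
commute with exp Z by uniqueness of integral curves.

The analytic input is that [X,Y] is the derivative of the pull-back of Y along the flow of X
(`hasDerivAt_mpullback_flow`). It supplies both the Killing equation and the truncated exponential.
-/

section NilpotentIdeals

variable {L : Type*} [LieRing L] [LieAlgebra ℝ L]

/-- A nilpotent ideal acts nilpotently on the whole Lie algebra. -/
theorem LieIdeal.exists_lcs_eq_bot_of_isNilpotent (J : LieIdeal ℝ L) (h : LieRing.IsNilpotent J) :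
    ∃ k, J.lcs L k = ⊥ := by
  obtain ⟨k, hk⟩ := (LieModule.isNilpotent_iff ℝ J J).1 h
  -- The shift by one: the first term [J, L] is already inside J, and only from there on can the
  -- series be compared with that of J.
  refine ⟨k + 1, ?_⟩
  have key : ∀ k, (J.lcs L (k + 1)).toSubmodule ≤
      (LieModule.lowerCentralSeries ℝ J J k).toSubmodule.map J.toSubmodule.subtype := by
    intro k
    induction k with
    | zero =>
      intro x hx
      have hx' : x ∈ J := by
        rw [LieIdeal.lcs_succ] at hx
        exact LieSubmodule.lie_le_left _ _ hx
      exact ⟨⟨x, hx'⟩, by simp, rfl⟩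
    | succ k ih =>
      rw [LieIdeal.lcs_succ, LieSubmodule.lieIdeal_oper_eq_linear_span', Submodule.span_le]
      rintro _ ⟨x, hx, y, hy, rfl⟩
      obtain ⟨w, hw, rfl⟩ := ih hy
      refine ⟨⁅(⟨x, hx⟩ : J), w⁆, ?_, rfl⟩
      rw [LieModule.lowerCentralSeries_succ]
      exact LieSubmodule.lie_mem_lie (LieSubmodule.mem_top _) hw
  rw [eq_bot_iff]
  intro x hx
  obtain ⟨w, hw, rfl⟩ := key k hx
  rw [hk] at hw
  simpa using hw

theorem LieIdeal.iterate_lie_mono (J : LieIdeal ℝ L) (k : ℕ) :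
    Monotone (fun N : LieIdeal ℝ L => ⁅J, N⁆)^[k] :=
  Monotone.iterate (fun _ _ h => LieSubmodule.mono_lie_right _ h) k

/-- Fitting's theorem, in terms of iterated brackets. -/
theorem LieIdeal.iterate_sup_lie_eq_bot (I J : LieIdeal ℝ L) :
    ∀ (m k l : ℕ), k + l = m → ∀ N : LieIdeal ℝ L,
      (fun N : LieIdeal ℝ L => ⁅I, N⁆)^[k] N = ⊥ → (fun N : LieIdeal ℝ L => ⁅J, N⁆)^[l] N = ⊥ →
        (fun N : LieIdeal ℝ L => ⁅I ⊔ J, N⁆)^[m] N = ⊥ := by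
  have hbot : ∀ (S : LieIdeal ℝ L) (m : ℕ), (fun N : LieIdeal ℝ L => ⁅S, N⁆)^[m] ⊥ = ⊥ := by
    intro S m
    exact Function.iterate_fixed (LieSubmodule.lie_bot S) m
  have hsup : ∀ (S : LieIdeal ℝ L) (m : ℕ) (A B : LieIdeal ℝ L),
      (fun N : LieIdeal ℝ L => ⁅S, N⁆)^[m] (A ⊔ B) =
        (fun N : LieIdeal ℝ L => ⁅S, N⁆)^[m] A ⊔ (fun N : LieIdeal ℝ L => ⁅S, N⁆)^[m] B := by
    intro S m
    induction m with
    | zero => intro A B; rfl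
    | succ m ih =>
      intro A B
      simp only [Function.iterate_succ_apply]
      rw [LieSubmodule.lie_sup, ih]
  intro m
  induction m with
  | zero =>
    intro k l hkl N hk hl
    obtain rfl : k = 0 := by omega
    exact hk
  | succ m ih =>
    intro k l hkl N hk hl
    rcases k with _ | k
    · obtain rfl : N = ⊥ := hk
      exact hbot _ _
    rcases l with _ | l
    · obtain rfl : N = ⊥ := hl
      exact hbot _ _
    rw [Function.iterate_succ_apply]
    -- On [I, N] one bracket with I is already spent, while the bound for J persists because [I, N]
    -- ≤ N; symmetrically for [J, N]. Both summands fall under the induction hypothesis.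
    rw [LieSubmodule.sup_lie, hsup]
    rw [ih k (l + 1) (by omega) ⁅I, N⁆ hk, ih (k + 1) l (by omega) ⁅J, N⁆ _ hl, sup_bot_eq]
    · rw [eq_bot_iff, ← hk]
      exact LieIdeal.iterate_lie_mono I (k + 1) (LieSubmodule.lie_le_right N J)
    · rw [eq_bot_iff, ← hl]
      exact LieIdeal.iterate_lie_mono J (l + 1) (LieSubmodule.lie_le_right N I)

theorem LieIdeal.exists_lcs_sup_eq_bot {I J : LieIdeal ℝ L} (hI : ∃ k, I.lcs L k = ⊥)
    (hJ : ∃ k, J.lcs L k = ⊥) : ∃ k, (I ⊔ J).lcs L k = ⊥ := by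
  obtain ⟨k, hk⟩ := hI
  obtain ⟨l, hl⟩ := hJ
  exact ⟨k + l, LieIdeal.iterate_sup_lie_eq_bot I J _ k l rfl ⊤ hk hl⟩

/-- By Fitting's theorem the nilpotent ideals form a directed family, so their union is already an
ideal and equals their sum. This replaces nilpotency of the nilradical itself, which is not
available without a finiteness assumption on L. -/
theorem WeaklySymmetric.exists_ideal_of_mem_lieNilradical {x : L}
    (hx : x ∈ WeaklySymmetric.lieNilradical L) :
    ∃ J : LieIdeal ℝ L, (∃ k, J.lcs L k = ⊥) ∧ x ∈ J := by
  let K : LieIdeal ℝ L :=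
    { carrier := {x | ∃ J : LieIdeal ℝ L, (∃ k, J.lcs L k = ⊥) ∧ x ∈ J}
      add_mem' := by
        rintro x y ⟨I, hI, hx⟩ ⟨J, hJ, hy⟩
        exact ⟨I ⊔ J, LieIdeal.exists_lcs_sup_eq_bot hI hJ,
          add_mem ((le_sup_left : I ≤ I ⊔ J) hx) ((le_sup_right : J ≤ I ⊔ J) hy)⟩
      zero_mem' := ⟨⊥, ⟨1, by simp⟩, zero_mem _⟩
      smul_mem' := fun c x ⟨J, hJ, hx⟩ => ⟨J, hJ, J.smul_mem c hx⟩
      lie_mem := fun {x m} ⟨J, hJ, hm⟩ => ⟨J, hJ, J.lie_mem hm⟩ }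
  have hK : WeaklySymmetric.lieNilradical L ≤ K :=
    sSup_le fun J hJ x hx => ⟨J, J.exists_lcs_eq_bot_of_isNilpotent hJ, hx⟩
  exact hK hx

theorem WeaklySymmetric.exists_ideal_of_finset_subset_lieNilradical (t : Finset L)
    (ht : ∀ x ∈ t, x ∈ WeaklySymmetric.lieNilradical L) :
    ∃ J : LieIdeal ℝ L, (∃ k, J.lcs L k = ⊥) ∧ ∀ x ∈ t, x ∈ J := by
  classical
  induction t using Finset.induction_on with
  | empty => exact ⟨⊥, ⟨1, by simp⟩, by simp⟩
  | insert a s _ ih =>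
    obtain ⟨I, hI, hIs⟩ := ih fun x hx => ht x (Finset.mem_insert_of_mem hx)
    obtain ⟨J, hJ, ha⟩ :=
      WeaklySymmetric.exists_ideal_of_mem_lieNilradical (ht a (Finset.mem_insert_self _ _))
    refine ⟨I ⊔ J, LieIdeal.exists_lcs_sup_eq_bot hI hJ, fun x hx => ?_⟩
    rcases Finset.mem_insert.1 hx with rfl | hx
    · exact (le_sup_right : J ≤ I ⊔ J) ha
    · exact (le_sup_left : I ≤ I ⊔ J) (hIs x hx)

/-- The elements of the nilradical are ad-nilpotent. -/
theorem WeaklySymmetric.exists_iterate_lie_eq_zero_of_mem_lieNilradical {x : L}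
    (hx : x ∈ WeaklySymmetric.lieNilradical L) :
    ∃ k, ∀ y, (fun y : L => ⁅x, y⁆)^[k] y = 0 := by
  obtain ⟨J, ⟨k, hk⟩, hxJ⟩ := WeaklySymmetric.exists_ideal_of_mem_lieNilradical hx
  refine ⟨k, fun y => ?_⟩
  have : ∀ k, (fun y : L => ⁅x, y⁆)^[k] y ∈ J.lcs L k := by
    intro k
    induction k with
    | zero => simp
    | succ k ih =>
      rw [LieIdeal.lcs_succ, Function.iterate_succ_apply']
      exact LieSubmodule.lie_mem_lie hxJ ih
  simpa [hk] using this k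

theorem WeaklySymmetric.lieNilradical_map_le (e : L ≃ₗ⁅ℝ⁆ L) {x : L}
    (hx : x ∈ WeaklySymmetric.lieNilradical L) : e x ∈ WeaklySymmetric.lieNilradical L := by
  have h : WeaklySymmetric.lieNilradical L ≤
      (WeaklySymmetric.lieNilradical L).comap (e : L →ₗ⁅ℝ⁆ L) := by
    refine sSup_le fun J hJ y hy => ?_
    rw [LieIdeal.mem_comap]
    -- This is the image e(J), written as a preimage under the inverse so that it is an ideal by
    -- construction.
    let J' : LieIdeal ℝ L := J.comap (e.symm : L →ₗ⁅ℝ⁆ L)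
    have hJ' : LieRing.IsNilpotent J' := by
      let f : J' →ₗ⁅ℝ⁆ J :=
        { toFun := fun w => ⟨e.symm w, LieIdeal.mem_comap.1 w.2⟩
          map_add' := fun a b => Subtype.ext (by simp)
          map_smul' := fun a b => Subtype.ext (by simp)
          map_lie' := fun {a b} => Subtype.ext (LieEquiv.map_lie e.symm a.1 b.1) }
      have hf : Function.Injective f := fun a b hab => by
        have : e.symm a = e.symm b := congrArg Subtype.val hab
        exact Subtype.ext (e.symm.injective this)
      have : LieRing.IsNilpotent J := hJ
      exact hf.lieAlgebra_isNilpotent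
    refine (le_sSup hJ' : J' ≤ _) ?_
    rw [LieIdeal.mem_comap]
    simpa using hy
  exact h hx

theorem WeaklySymmetric.lie_lieNilradical_map_le (e : L ≃ₗ⁅ℝ⁆ L) {x : L}
    (hx : x ∈ ⁅WeaklySymmetric.lieNilradical L, WeaklySymmetric.lieNilradical L⁆) :
    e x ∈ ⁅WeaklySymmetric.lieNilradical L, WeaklySymmetric.lieNilradical L⁆ := by
  have h : ⁅WeaklySymmetric.lieNilradical L, WeaklySymmetric.lieNilradical L⁆ ≤
      LieIdeal.comap (e : L →ₗ⁅ℝ⁆ L)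
        ⁅WeaklySymmetric.lieNilradical L, WeaklySymmetric.lieNilradical L⁆ := by
    rw [LieSubmodule.lie_le_iff]
    intro a ha b hb
    rw [LieIdeal.mem_comap, LieHom.map_lie]
    exact LieSubmodule.lie_mem_lie (WeaklySymmetric.lieNilradical_map_le e ha)
      (WeaklySymmetric.lieNilradical_map_le e hb)
  exact h hx

end NilpotentIdeals

/-! ### Skew nilpotent maps on a definite space force [𝔫, [𝔫, 𝔫]] = 0 -/

section Definite

variable {L : Type*} [LieRing L] [LieAlgebra ℝ L]
  {E : Type*} [AddCommGroup E] [Module ℝ E] [FiniteDimensional ℝ E]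

/-- The algebraic core: if `B` is positive definite on `[𝔫, 𝔫]` and `ad Y` has no
diagonal on `[𝔫, 𝔫]` for `Y ∈ 𝔫` orthogonal to `[𝔫, 𝔫]`, then `[𝔫, [𝔫, 𝔫]] = 0`. -/
theorem WeaklySymmetric.lie_lie_lieNilradical_eq_bot (ev : L →ₗ[ℝ] E) (B : E →ₗ[ℝ] E →ₗ[ℝ] ℝ)
    (hsymm : ∀ v w, B v w = B w v)
    (hpos : ∀ X ∈ ⁅lieNilradical L, lieNilradical L⁆, X ≠ 0 → 0 < B (ev X) (ev X))
    (hdiag : ∀ X ∈ ⁅lieNilradical L, lieNilradical L⁆, ∀ Y ∈ lieNilradical L,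
      (∀ Z ∈ ⁅lieNilradical L, lieNilradical L⁆, B (ev Y) (ev Z) = 0) → B (ev ⁅X, Y⁆) (ev X) = 0) :
    ⁅lieNilradical L, ⁅lieNilradical L, lieNilradical L⁆⁆ = ⊥ := by
  set N := lieNilradical L with hN
  set Z : LieIdeal ℝ L := ⁅N, N⁆ with hZ
  have hZN : Z ≤ N := LieSubmodule.lie_le_left _ _
  have hdef0 : ∀ X ∈ Z, B (ev X) (ev X) = 0 → X = 0 := fun X hX h => by
    by_contra hne
    exact (hpos X hX hne).ne' h
  -- `Z` is finite-dimensional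
  have hinj : Function.Injective (ev.comp Z.toSubmodule.subtype) := by
    rw [← LinearMap.ker_eq_bot, LinearMap.ker_eq_bot']
    intro X hX
    have hX' : ev X.1 = 0 := hX
    exact Subtype.ext (hdef0 X.1 X.2 (by rw [hX']; simp))
  have hfin : FiniteDimensional ℝ Z.toSubmodule := FiniteDimensional.of_injective _ hinj
  -- orthogonal decomposition
  have hdec : ∀ Y ∈ N, ∃ W ∈ Z, ∀ T ∈ Z, B (ev (Y - W)) (ev T) = 0 := by
    intro Y hY
    let β : Z.toSubmodule →ₗ[ℝ] Z.toSubmodule →ₗ[ℝ] ℝ :=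
      B.compl₁₂ (ev.comp Z.toSubmodule.subtype) (ev.comp Z.toSubmodule.subtype)
    have hβ : Function.Injective β := by
      rw [← LinearMap.ker_eq_bot, LinearMap.ker_eq_bot']
      intro X hX
      exact Subtype.ext (hdef0 X.1 X.2 (LinearMap.congr_fun hX X))
    have hβs : Function.Surjective β :=
      (LinearMap.injective_iff_surjective_of_finrank_eq_finrank
        (Subspace.dual_finrank_eq (K := ℝ) (V := Z.toSubmodule)).symm).1 hβ
    obtain ⟨W, hW⟩ := hβs ((B (ev Y)).comp (ev.comp Z.toSubmodule.subtype))
    refine ⟨W.1, W.2, fun T hT => ?_⟩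
    have h := LinearMap.congr_fun hW ⟨T, hT⟩
    have h' : B (ev W.1) (ev T) = B (ev Y) (ev T) := h
    rw [map_sub, map_sub, LinearMap.sub_apply, h', sub_self]
  -- the orthogonal complement centralizes `Z`
  have hcent : ∀ Y ∈ N, (∀ T ∈ Z, B (ev Y) (ev T) = 0) → ∀ X ∈ Z, ⁅Y, X⁆ = 0 := by
    intro Y hY hYo
    have hYZ : ∀ X ∈ Z, ⁅Y, X⁆ ∈ Z := fun X hX => Z.lie_mem hX
    have hd : ∀ X ∈ Z, B (ev ⁅Y, X⁆) (ev X) = 0 := fun X hX => by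
      rw [← lie_skew, map_neg, map_neg, LinearMap.neg_apply, hdiag X hX Y hY hYo, neg_zero]
    -- Polarization of the vanishing diagonal.
    have hskew : ∀ X ∈ Z, ∀ X' ∈ Z, B (ev ⁅Y, X⁆) (ev X') = - B (ev X) (ev ⁅Y, X'⁆) := by
      intro X hX X' hX'
      have h := hd (X + X') (add_mem hX hX')
      simp only [lie_add, map_add, LinearMap.add_apply, hd X hX, hd X' hX'] at h
      rw [hsymm (ev X)]
      linarith
    obtain ⟨k, hk⟩ := exists_iterate_lie_eq_zero_of_mem_lieNilradical (hN ▸ hY)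
    have hmem : ∀ j, ∀ X ∈ Z, (fun y : L => ⁅Y, y⁆)^[j] X ∈ Z := by
      intro j X hX
      induction j with
      | zero => exact hX
      | succ j ih => rw [Function.iterate_succ_apply']; exact hYZ _ ih
    -- A nilpotent skew map A of a definite space is zero: if A^(j+2) = 0, then ⟨A^(j+1)X, A^(j+1)X⟩
    -- = -⟨A^j X, A^(j+2)X⟩ = 0, so the exponent descends to 1.
    have hdown : ∀ j, (∀ X ∈ Z, (fun y : L => ⁅Y, y⁆)^[j + 1] X = 0) → ∀ X ∈ Z, ⁅Y, X⁆ = 0 := by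
      intro j
      induction j with
      | zero => intro h X hX; exact h X hX
      | succ j ih =>
        intro h
        refine ih fun X hX => hdef0 _ (hmem _ X hX) ?_
        have h2 := h X hX
        rw [Function.iterate_succ_apply'] at h2
        have h1 : (fun y : L => ⁅Y, y⁆)^[j + 1] X = ⁅Y, (fun y : L => ⁅Y, y⁆)^[j] X⁆ :=
          Function.iterate_succ_apply' _ _ _
        have h3 := hskew _ (hmem j X hX) _ (hmem (j + 1) X hX)
        rw [← h1] at h3
        rw [h3]
        have h2' : ⁅Y, (fun y : L => ⁅Y, y⁆)^[j + 1] X⁆ = 0 := h2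
        rw [h2']
        simp
    exact hdown k fun X _ => by rw [Function.iterate_succ_apply, hk]
  -- `[𝔫, Z] = [Z, Z] = [Z, [Z, Z]]`
  have h1 : ⁅N, Z⁆ ≤ ⁅Z, Z⁆ := by
    rw [LieSubmodule.lie_le_iff]
    intro Y hY X hX
    obtain ⟨W, hW, hWo⟩ := hdec Y hY
    have h := hcent (Y - W) (sub_mem hY (hZN hW)) hWo X hX
    rw [sub_lie, sub_eq_zero] at h
    rw [h]
    exact LieSubmodule.lie_mem_lie hW hX
  have h2 : ⁅Z, Z⁆ ≤ ⁅Z, ⁅Z, Z⁆⁆ := by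
    rw [LieSubmodule.lie_le_iff]
    intro X hX X' hX'
    have hX'' : X' ∈ LieSubmodule.toSubmodule ⁅N, N⁆ := hX'
    rw [LieSubmodule.lieIdeal_oper_eq_linear_span'] at hX''
    induction hX'' using Submodule.span_induction with
    | zero => rw [lie_zero]; exact zero_mem _
    | add u v _ _ hu hv =>
      rename_i hu' hv'
      rw [lie_add]
      refine add_mem (hu ?_) (hv ?_)
      · rw [← LieSubmodule.mem_toSubmodule, hZ, LieSubmodule.lieIdeal_oper_eq_linear_span']
        exact hu'
      · rw [← LieSubmodule.mem_toSubmodule, hZ, LieSubmodule.lieIdeal_oper_eq_linear_span']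
        exact hv'
    | smul c u hu' hu =>
      rw [lie_smul]
      refine SMulMemClass.smul_mem c (hu ?_)
      rw [← LieSubmodule.mem_toSubmodule, hZ, LieSubmodule.lieIdeal_oper_eq_linear_span']
      exact hu'
    | mem u hu =>
      -- Write Y = V + W and Y' = V' + W' with W, W' in Z and V, V' centralizing Z. The mixed
      -- brackets vanish, and X commutes with [V, V'] by the Jacobi identity, so [X, [Y, Y']] = [X,
      -- [W, W']].
      obtain ⟨Y, hY, Y', hY', rfl⟩ := hu
      obtain ⟨W, hW, hWo⟩ := hdec Y hY
      obtain ⟨W', hW', hWo'⟩ := hdec Y' hY'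
      have e1 := hcent (Y - W) (sub_mem hY (hZN hW)) hWo X hX
      have e2 := hcent (Y' - W') (sub_mem hY' (hZN hW')) hWo' X hX
      have e3 := hcent (Y - W) (sub_mem hY (hZN hW)) hWo W' hW'
      have e4 := hcent (Y' - W') (sub_mem hY' (hZN hW')) hWo' W hW
      have e5 : ⁅X, ⁅Y - W, Y' - W'⁆⁆ = 0 := by
        rw [leibniz_lie, ← lie_skew X (Y - W), e1, ← lie_skew X (Y' - W'), e2]
        simp
      have e4' : ⁅W, Y' - W'⁆ = 0 := by rw [← lie_skew, e4, neg_zero]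
      have e6 : ⁅Y, Y'⁆ = ⁅Y - W, Y' - W'⁆ + ⁅W, W'⁆ := by
        have : ⁅Y, Y'⁆ = ⁅(Y - W) + W, (Y' - W') + W'⁆ := by simp only [sub_add_cancel]
        rw [this, add_lie, lie_add, lie_add, e3, e4', add_zero, zero_add]
      rw [e6, lie_add, e5, zero_add]
      exact LieSubmodule.lie_mem_lie hX (LieSubmodule.lie_mem_lie hW hW')
  -- nilpotency
  obtain ⟨t, ht⟩ := (Submodule.fg_iff_finiteDimensional Z.toSubmodule).2 hfin
  obtain ⟨J, ⟨k, hk⟩, htJ⟩ := exists_ideal_of_finset_subset_lieNilradical t fun x hx =>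
    hZN (show x ∈ Z.toSubmodule from ht ▸ Submodule.subset_span hx)
  have hZJ : Z ≤ J := by
    rw [← LieSubmodule.toSubmodule_le_toSubmodule, ← ht, Submodule.span_le]
    exact htJ
  have h3 : ∀ k, ⁅Z, Z⁆ ≤ J.lcs L k := by
    intro k
    induction k with
    | zero => simp
    | succ k ih =>
      rw [LieIdeal.lcs_succ]
      exact h2.trans (LieSubmodule.mono_lie hZJ ih)
  rw [eq_bot_iff, ← hk]
  exact h1.trans (h3 k)

end Definite

/-! ### The Lie derivative formula in a vector space -/

section LieDerivative

open VectorField Filter Topology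

/-- Inversion has derivative -id at 1. This case suffices because the differential of a flow is the
identity at time zero. -/
theorem HasDerivAt.ringInverse_of_eq_one {R : Type*} [NormedRing R] [NormedAlgebra ℝ R]
    [HasSummableGeomSeries R] {A : ℝ → R} {A' : R} {t : ℝ} (hA : HasDerivAt A A' t)
    (h1 : A t = 1) : HasDerivAt (fun s => Ring.inverse (A s)) (-A') t := by
  have h := hasFDerivAt_ringInverse (𝕜 := ℝ) (1 : Rˣ)
  rw [Units.val_one, ← h1] at h
  refine (h.comp_hasDerivAt t hA).congr_deriv ?_
  change -(((1 : Rˣ)⁻¹ : Rˣ) * A' * ((1 : Rˣ)⁻¹ : Rˣ)) = -A'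
  simp

/-- The bracket of vector fields is the derivative of the pull-back along the flow, in a
vector space. -/
theorem VectorField.hasDerivAt_pullback_flow {E : Type*} [NormedAddCommGroup E] [NormedSpace ℝ E]
    [CompleteSpace E] {Φ : ℝ × E → E} {X Y : E → E} {y₀ : E} (hΦ : ContDiffAt ℝ 2 Φ (0, y₀))
    (h0 : ∀ᶠ y in 𝓝 y₀, Φ (0, y) = y)
    (hX : ∀ᶠ y in 𝓝 y₀, HasDerivAt (fun t => Φ (t, y)) (X y) 0) (hY : DifferentiableAt ℝ Y y₀) :
    HasDerivAt (fun t => (fderiv ℝ (fun y => Φ (t, y)) y₀).inverse (Y (Φ (t, y₀))))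
      (lieBracket ℝ X Y y₀) 0 := by
  have hdiff : ∀ᶠ q in 𝓝 ((0 : ℝ), y₀), DifferentiableAt ℝ Φ q := by
    filter_upwards [hΦ.eventually (by simp)] with q hq
    exact hq.differentiableAt (by simp)
  have hF : DifferentiableAt ℝ (fderiv ℝ Φ) (0, y₀) :=
    (hΦ.fderiv_right (m := 1) (by norm_num)).differentiableAt (by simp)
  set F' := fderiv ℝ (fderiv ℝ Φ) (0, y₀) with hF'
  have hsymm : IsSymmSndFDerivAt ℝ Φ (0, y₀) :=
    hΦ.isSymmSndFDerivAt (by simp)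
  have hcurve : HasDerivAt (fun t : ℝ => (t, y₀)) ((1 : ℝ), (0 : E)) 0 :=
    (hasDerivAt_id (0 : ℝ)).prodMk (hasDerivAt_const 0 y₀)
  -- the derivative in the space direction
  have hA : HasDerivAt (fun t : ℝ => (fderiv ℝ (fun y => Φ (t, y)) y₀))
      ((F' (1, 0)).comp (ContinuousLinearMap.inr ℝ ℝ E)) 0 := by
    have h1 : HasDerivAt (fun t : ℝ => (fderiv ℝ Φ (t, y₀))) (F' (1, 0)) 0 :=
      HasFDerivAt.comp_hasDerivAt (x := (0 : ℝ)) (f := fun t : ℝ => (t, y₀)) (hl := hF.hasFDerivAt) (hf := hcurve)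
    have h2 := (((ContinuousLinearMap.compL ℝ E (ℝ × E) E).flip
      (ContinuousLinearMap.inr ℝ ℝ E)).hasFDerivAt.comp_hasDerivAt (0 : ℝ) h1)
    refine h2.congr_of_eventuallyEq ?_
    have : Tendsto (fun t : ℝ => (t, y₀)) (𝓝 0) (𝓝 (0, y₀)) := hcurve.continuousAt
    filter_upwards [this.eventually hdiff] with t ht
    have h3 : HasFDerivAt (fun y : E => (t, y)) (ContinuousLinearMap.inr ℝ ℝ E) y₀ :=
      hasFDerivAt_prodMk_right t y₀
    exact (HasFDerivAt.comp (f := fun y : E => (t, y)) y₀ ht.hasFDerivAt h3).fderiv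
  have hA0 : fderiv ℝ (fun y => Φ (0, y)) y₀ = ContinuousLinearMap.id ℝ E := by
    have : (fun y => Φ (0, y)) =ᶠ[𝓝 y₀] id := h0
    rw [this.fderiv_eq, fderiv_id]
  -- the derivative of `X`
  have hXd : HasFDerivAt X ((ContinuousLinearMap.apply ℝ E ((1 : ℝ), (0 : E))).comp
      (F'.comp (ContinuousLinearMap.inr ℝ ℝ E))) y₀ := by
    have h3 : HasFDerivAt (fun y : E => ((0 : ℝ), y)) (ContinuousLinearMap.inr ℝ ℝ E) y₀ :=
      hasFDerivAt_prodMk_right 0 y₀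
    have h4 : HasFDerivAt (fun y : E => fderiv ℝ Φ ((0 : ℝ), y))
      (F'.comp (ContinuousLinearMap.inr ℝ ℝ E)) y₀ :=
      HasFDerivAt.comp (f := fun y : E => ((0 : ℝ), y)) y₀ hF.hasFDerivAt h3
    have h5 := (ContinuousLinearMap.apply ℝ E ((1 : ℝ), (0 : E))).hasFDerivAt.comp y₀ h4
    refine h5.congr_of_eventuallyEq ?_
    filter_upwards [hX, h3.continuousAt.eventually hdiff] with y hy hy'
    have h6 : HasDerivAt (fun t : ℝ => Φ (t, y)) (fderiv ℝ Φ (0, y) (1, 0)) 0 :=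
      HasFDerivAt.comp_hasDerivAt (x := (0 : ℝ)) (f := fun t : ℝ => (t, y))
        (hl := hy'.hasFDerivAt) (hf := (hasDerivAt_id (0 : ℝ)).prodMk (hasDerivAt_const 0 y))
    exact hy.unique h6
  have hAi : HasDerivAt (fun t : ℝ => (fderiv ℝ (fun y => Φ (t, y)) y₀).inverse)
      (-((F' (1, 0)).comp (ContinuousLinearMap.inr ℝ ℝ E))) 0 := by
    simpa only [ContinuousLinearMap.ringInverse_eq_inverse] using hA.ringInverse_of_eq_one hA0
  have hY0 : HasDerivAt (fun t => Y (Φ (t, y₀))) (fderiv ℝ Y y₀ (X y₀)) 0 := by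
    have hy : HasFDerivAt Y (fderiv ℝ Y y₀) (Φ (0, y₀)) := by
      rw [h0.self_of_nhds]; exact hY.hasFDerivAt
    exact hy.comp_hasDerivAt (0 : ℝ) hX.self_of_nhds
  have hmain := hAi.clm_apply hY0
  refine hmain.congr_deriv ?_
  -- The time derivative of the spatial differential and the spatial derivative of X are the two
  -- mixed second derivatives of Φ. Their symmetry turns the product rule into DY·X - DX·Y.
  have hs := hsymm (1, 0) (0, Y y₀)
  simp only [hA0, h0.self_of_nhds, lieBracket_eq, hXd.fderiv]
  have hid : (ContinuousLinearMap.id ℝ E).inverse = ContinuousLinearMap.id ℝ E :=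
    ContinuousLinearMap.inverse_id
  rw [hid]
  simp only [neg_apply, ContinuousLinearMap.comp_apply, ContinuousLinearMap.inr_apply,
    ContinuousLinearMap.apply_apply, ContinuousLinearMap.id_apply]
  rw [← hF'] at hs
  rw [hs]
  abel

end LieDerivative

/-! ### The Lie derivative formula on a manifold, read in one chart -/

section ManifoldLieDerivative

open VectorField Filter Topology

variable {n : ℕ} {M : Type*} [TopologicalSpace M] [ChartedSpace (EuclideanSpace ℝ (Fin n)) M]
  [IsManifold (𝓡 n) ∞ M]

/-- The inverse of the differential of a map, read in the charts at `x` in the source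
and in the target. -/
theorem VectorField.mpullback_apply_eq_inverse_fderiv {f : M → M} {x : M}
    (hf : MDifferentiableAt (𝓡 n) (𝓡 n) f x)
    (hfx : f x ∈ (extChartAt (𝓡 n) x).source) (Y : (y : M) → TangentSpace (𝓡 n) y) :
    (mpullback (𝓡 n) (𝓡 n) f Y x : EuclideanSpace ℝ (Fin n)) =
      (fderiv ℝ (fun y => extChartAt (𝓡 n) x (f ((extChartAt (𝓡 n) x).symm y)))
        (extChartAt (𝓡 n) x x)).inverse
      (mpullback 𝓘(ℝ, EuclideanSpace ℝ (Fin n)) (𝓡 n) (extChartAt (𝓡 n) x).symm Y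
        (extChartAt (𝓡 n) x (f x))) := by
  set e := extChartAt (𝓡 n) x with he
  have hx : x ∈ e.source := mem_extChartAt_source x
  have hes : ∀ y ∈ e.target, MDifferentiableAt 𝓘(ℝ, EuclideanSpace ℝ (Fin n)) (𝓡 n) e.symm y := by
    intro y hy
    have := mdifferentiableWithinAt_extChartAt_symm (I := 𝓡 n) hy
    rwa [ModelWithCorners.range_eq_univ, mdifferentiableWithinAt_univ] at this
  have he1 : MDifferentiableAt (𝓡 n) 𝓘(ℝ, EuclideanSpace ℝ (Fin n)) e (f x) :=
    mdifferentiableAt_extChartAt (by simpa [he] using hfx)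
  have hex : MDifferentiableAt (𝓡 n) 𝓘(ℝ, EuclideanSpace ℝ (Fin n)) e x :=
    mdifferentiableAt_extChartAt (by simp)
  have hinv : (mfderiv 𝓘(ℝ, EuclideanSpace ℝ (Fin n)) (𝓡 n) e.symm (e (f x))).IsInvertible := by
    have := isInvertible_mfderivWithin_extChartAt_symm (I := 𝓡 n) (e.map_source hfx)
    rwa [ModelWithCorners.range_eq_univ, mfderivWithin_univ] at this
  have hxx : e.symm (e x) = x := e.left_inv hx
  -- T_xM is identified with the model space through the preferred chart at x, so the differential
  -- of that chart's inverse is the identity there and drops out of the formula.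
  have hsymm1 : mfderiv 𝓘(ℝ, EuclideanSpace ℝ (Fin n)) (𝓡 n) e.symm (e x)
      = ContinuousLinearMap.id ℝ (EuclideanSpace ℝ (Fin n)) := by
    have := mfderivWithin_range_extChartAt_symm (I := 𝓡 n) (x := x)
    rwa [ModelWithCorners.range_eq_univ, mfderivWithin_univ] at this
  set Φ : EuclideanSpace ℝ (Fin n) → EuclideanSpace ℝ (Fin n) := fun y => e (f (e.symm y)) with hΦ
  have hΦx : Φ (e x) = e (f x) := by simp [hΦ, hxx]
  have hfe : MDifferentiableAt 𝓘(ℝ, EuclideanSpace ℝ (Fin n)) (𝓡 n) (f ∘ e.symm) (e x) :=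
    MDifferentiableAt.comp (e x) (by rw [hxx]; exact hf) (hes _ (e.map_source hx))
  have hΦd : MDifferentiableAt 𝓘(ℝ, EuclideanSpace ℝ (Fin n)) 𝓘(ℝ, EuclideanSpace ℝ (Fin n))
      Φ (e x) := by
    refine MDifferentiableAt.comp (g := e) (f := f ∘ e.symm) (e x) ?_ hfe
    simpa [hxx] using he1
  -- `f ∘ e.symm = e.symm ∘ Φ` near `e x`
  have hev : f ∘ e.symm =ᶠ[𝓝 (e x)] e.symm ∘ Φ := by
    have hc : ContinuousAt (f ∘ e.symm) (e x) := hfe.continuousAt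
    have hs : e.source ∈ 𝓝 ((f ∘ e.symm) (e x)) := by
      simp only [Function.comp, hxx]
      exact (isOpen_extChartAt_source x).mem_nhds hfx
    filter_upwards [hc.preimage_mem_nhds hs] with y hy
    exact (e.left_inv hy).symm
  have h1 : mfderiv 𝓘(ℝ, EuclideanSpace ℝ (Fin n)) (𝓡 n) (f ∘ e.symm) (e x)
      = (mfderiv 𝓘(ℝ, EuclideanSpace ℝ (Fin n)) (𝓡 n) e.symm (Φ (e x))).comp
        (mfderiv 𝓘(ℝ, EuclideanSpace ℝ (Fin n)) 𝓘(ℝ, EuclideanSpace ℝ (Fin n)) Φ (e x)) := by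
    rw [hev.mfderiv_eq]
    exact mfderiv_comp (e x) (by rw [hΦx]; exact hes _ (e.map_source hfx)) hΦd
  have h2 : mfderiv 𝓘(ℝ, EuclideanSpace ℝ (Fin n)) (𝓡 n) (f ∘ e.symm) (e x)
      = (mfderiv (𝓡 n) (𝓡 n) f (e.symm (e x))).comp
        (mfderiv 𝓘(ℝ, EuclideanSpace ℝ (Fin n)) (𝓡 n) e.symm (e x)) :=
    mfderiv_comp (e x) (by rw [hxx]; exact hf) (hes _ (e.map_source hx))
  -- Every tangent space is definitionally the model space. Giving the differentials this fixed type
  -- lets base points be rewritten without dependent-type obstructions.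
  let D : M → EuclideanSpace ℝ (Fin n) →L[ℝ] EuclideanSpace ℝ (Fin n) :=
    fun a => mfderiv (𝓡 n) (𝓡 n) f a
  let P : EuclideanSpace ℝ (Fin n) → EuclideanSpace ℝ (Fin n) →L[ℝ] EuclideanSpace ℝ (Fin n) :=
    fun y => mfderiv 𝓘(ℝ, EuclideanSpace ℝ (Fin n)) (𝓡 n) e.symm y
  let Z : M → EuclideanSpace ℝ (Fin n) := fun a => Y a
  have h3 : (P (Φ (e x))).comp (fderiv ℝ Φ (e x)) = (D (e.symm (e x))).comp (P (e x)) := by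
    have h := h1.symm.trans h2
    rw [mfderiv_eq_fderiv] at h
    exact h
  have h4 : P (e x) = ContinuousLinearMap.id ℝ _ := hsymm1
  rw [h4, hxx, hΦx, ContinuousLinearMap.comp_id] at h3
  have hinv' : (P (e (f x))).IsInvertible := hinv
  change (D x).inverse (Z (f x)) =
    (fderiv ℝ Φ (e x)).inverse ((P (e (f x))).inverse (Z (e.symm (e (f x)))))
  rw [← h3, hinv'.inverse_comp_apply_of_left, e.left_inv hfx]

/-- The bracket of vector fields is the derivative of the pull-back along the flow. -/
theorem VectorField.hasDerivAt_mpullback_flow {φ : ℝ → M → M}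
    (hφ : ContMDiff (𝓘(ℝ, ℝ).prod (𝓡 n)) (𝓡 n) ∞ (fun q : ℝ × M => φ q.1 q.2))
    (h0 : ∀ x, φ 0 x = x) {X Y : (x : M) → TangentSpace (𝓡 n) x}
    (hX : ∀ x, HasMFDerivAt 𝓘(ℝ, ℝ) (𝓡 n) (fun t => φ t x) 0
      ((1 : ℝ →L[ℝ] ℝ).smulRight (X (φ 0 x))))
    (x : M) (hY : MDifferentiableAt (𝓡 n) ((𝓡 n).prod 𝓘(ℝ, EuclideanSpace ℝ (Fin n)))
      (fun y ↦ (⟨y, Y y⟩ : TangentBundle (𝓡 n) M)) x) :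
    HasDerivAt (fun t => (mpullback (𝓡 n) (𝓡 n) (φ t) Y x : EuclideanSpace ℝ (Fin n)))
      (mlieBracket (𝓡 n) X Y x : EuclideanSpace ℝ (Fin n)) 0 := by
  set e := extChartAt (𝓡 n) x with he
  have hx : x ∈ e.source := mem_extChartAt_source x
  have hxx : e.symm (e x) = x := e.left_inv hx
  let Φ : ℝ × EuclideanSpace ℝ (Fin n) → EuclideanSpace ℝ (Fin n) :=
    fun q => e (φ q.1 (e.symm q.2))
  let X' : EuclideanSpace ℝ (Fin n) → EuclideanSpace ℝ (Fin n) :=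
    mpullback 𝓘(ℝ, EuclideanSpace ℝ (Fin n)) (𝓡 n) e.symm X
  let Y' : EuclideanSpace ℝ (Fin n) → EuclideanSpace ℝ (Fin n) :=
    mpullback 𝓘(ℝ, EuclideanSpace ℝ (Fin n)) (𝓡 n) e.symm Y
  have htarget : e.target ∈ 𝓝 (e x) := extChartAt_target_mem_nhds x
  have hφd : ∀ t, ContMDiff (𝓡 n) (𝓡 n) ∞ (φ t) := fun t =>
    hφ.comp (contMDiff_const.prodMk contMDiff_id)
  have hbr : (mlieBracket (𝓡 n) X Y x : EuclideanSpace ℝ (Fin n)) = lieBracket ℝ X' Y' (e x) := by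
    rw [mlieBracket, mlieBracketWithin_apply, mfderiv_extChartAt_self]
    simp only [ModelWithCorners.range_eq_univ, mpullbackWithin_univ, Set.preimage_univ,
      Set.inter_univ]
    change (ContinuousLinearMap.id ℝ (EuclideanSpace ℝ (Fin n))).inverse
      (lieBracketWithin ℝ X' Y' Set.univ (e x)) = _
    rw [ContinuousLinearMap.inverse_id, lieBracketWithin_univ]
    rfl
  have hY' : DifferentiableAt ℝ Y' (e x) := by
    have h2 : IsManifold (𝓡 n) 2 M := IsManifold.of_le (n := ∞)
      (WithTop.coe_le_coe.2 (le_top : (2 : ℕ∞) ≤ ⊤))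
    have := (mdifferentiableWithinAt_univ.2
      hY).differentiableWithinAt_mpullbackWithin_vectorField
    simp only [ModelWithCorners.range_eq_univ, mpullbackWithin_univ, Set.preimage_univ,
      Set.inter_univ] at this
    exact differentiableWithinAt_univ.1 this
  have hΦ : ContDiffAt ℝ 2 Φ (0, e x) := by
    have h1 : ContMDiffAt 𝓘(ℝ, EuclideanSpace ℝ (Fin n)) (𝓡 n) ∞ e.symm (e x) :=
      (contMDiffOn_extChartAt_symm x).contMDiffAt htarget
    have h2 : ContMDiffAt (𝓘(ℝ, ℝ).prod 𝓘(ℝ, EuclideanSpace ℝ (Fin n))) (𝓘(ℝ, ℝ).prod (𝓡 n)) ∞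
        (fun q : ℝ × EuclideanSpace ℝ (Fin n) => (q.1, e.symm q.2)) (0, e x) :=
      contMDiffAt_fst.prodMk (ContMDiffAt.comp (0, e x) h1 contMDiffAt_snd)
    have h3 : ContMDiffAt (𝓘(ℝ, ℝ).prod 𝓘(ℝ, EuclideanSpace ℝ (Fin n))) (𝓡 n) ∞
        (fun q : ℝ × EuclideanSpace ℝ (Fin n) => φ q.1 (e.symm q.2)) (0, e x) :=
      hφ.contMDiffAt.comp (0, e x) h2
    have h4 : ContMDiffAt (𝓡 n) 𝓘(ℝ, EuclideanSpace ℝ (Fin n)) ∞ e (φ 0 (e.symm (e x))) := by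
      rw [h0, hxx]; exact contMDiffAt_extChartAt
    have h5 : ContMDiffAt (𝓘(ℝ, ℝ).prod 𝓘(ℝ, EuclideanSpace ℝ (Fin n)))
        𝓘(ℝ, EuclideanSpace ℝ (Fin n)) ∞ Φ (0, e x) := h4.comp (0, e x) h3
    rw [← modelWithCornersSelf_prod, chartedSpaceSelf_prod, contMDiffAt_iff_contDiffAt] at h5
    exact h5.of_le (WithTop.coe_le_coe.2 (le_top : (2 : ℕ∞) ≤ ⊤))
  have hΦ0 : ∀ᶠ y in 𝓝 (e x), Φ (0, y) = y := by
    filter_upwards [htarget] with y hy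
    simp only [Φ, h0]
    exact e.right_inv hy
  have hΦX : ∀ᶠ y in 𝓝 (e x), HasDerivAt (fun t => Φ (t, y)) (X' y) 0 := by
    filter_upwards [htarget] with y hy
    have hys : e.symm y ∈ e.source := e.map_target hy
    have h1 : HasMFDerivAt (𝓡 n) 𝓘(ℝ, EuclideanSpace ℝ (Fin n)) e (φ 0 (e.symm y))
        (mfderiv (𝓡 n) 𝓘(ℝ, EuclideanSpace ℝ (Fin n)) e (φ 0 (e.symm y))) := by
      refine MDifferentiableAt.hasMFDerivAt ?_
      rw [h0]
      exact mdifferentiableAt_extChartAt (by simpa [he] using hys)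
    let D : M → EuclideanSpace ℝ (Fin n) →L[ℝ] EuclideanSpace ℝ (Fin n) :=
      fun a => mfderiv (𝓡 n) 𝓘(ℝ, EuclideanSpace ℝ (Fin n)) e a
    let P : EuclideanSpace ℝ (Fin n) →L[ℝ] EuclideanSpace ℝ (Fin n) :=
      mfderiv 𝓘(ℝ, EuclideanSpace ℝ (Fin n)) (𝓡 n) e.symm y
    let Z : M → EuclideanSpace ℝ (Fin n) := fun a => X a
    have h2 : HasFDerivAt (fun t => Φ (t, y)) ((D (φ 0 (e.symm y))).comp
        ((1 : ℝ →L[ℝ] ℝ).smulRight (Z (φ 0 (e.symm y))))) 0 :=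
      (h1.comp (0 : ℝ) (hX (e.symm y))).hasFDerivAt
    refine h2.hasDerivAt.congr_deriv ?_
    have h3 : (D (e.symm y)).comp P = ContinuousLinearMap.id ℝ _ := by
      have := mfderiv_extChartAt_comp_mfderivWithin_extChartAt_symm (I := 𝓡 n) hy
      rw [ModelWithCorners.range_eq_univ, mfderivWithin_univ] at this
      exact this
    have h4 : P.comp (D (e.symm y)) = ContinuousLinearMap.id ℝ _ := by
      have := mfderivWithin_extChartAt_symm_comp_mfderiv_extChartAt (I := 𝓡 n) hy
      rw [ModelWithCorners.range_eq_univ, mfderivWithin_univ] at this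
      exact this
    have h5 : P.inverse = D (e.symm y) := ContinuousLinearMap.inverse_eq h4 h3
    change D (φ 0 (e.symm y)) ((1 : ℝ) • Z (φ 0 (e.symm y))) = P.inverse (Z (e.symm y))
    rw [h5, h0, one_smul]
  rw [hbr]
  refine (hasDerivAt_pullback_flow hΦ hΦ0 hΦX hY').congr_of_eventuallyEq ?_
  have hcont : ContinuousAt (fun t => φ t x) 0 := (hX x).continuousAt
  have hs : e.source ∈ 𝓝 (φ 0 x) := by
    rw [h0]; exact (isOpen_extChartAt_source x).mem_nhds hx
  -- The chart formula holds only while the orbit of x stays in the chart at x, that is, for small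
  -- t; this is enough for a derivative at 0.
  filter_upwards [hcont.preimage_mem_nhds hs] with t ht
  rw [mpullback_apply_eq_inverse_fderiv ((hφd t).mdifferentiable (by simp) x) ht]
  simp only [Φ, Y', hxx]
  rfl

end ManifoldLieDerivative

noncomputable section

namespace WeaklySymmetric

variable {n : ℕ} {M : Type*} [TopologicalSpace M] [ChartedSpace (EuclideanSpace ℝ (Fin n)) M]
  [IsManifold (𝓡 n) ∞ M] {g : PseudoRiemannianMetric n M}

/-! ### The adjoint action of isometries on vector fields -/

theorem Isom.apply_inv_self (φ : Isom g) (x : M) : φ (φ⁻¹ x) = x := φ.toDiffeo.apply_symm_apply x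

theorem Isom.mdifferentiable (φ : Isom g) : MDifferentiable (𝓡 n) (𝓡 n) φ :=
  φ.toDiffeo.mdifferentiable (by simp)

/-- The differential of an isometry at `x`. -/
def Isom.differential (φ : Isom g) (x : M) :
    EuclideanSpace ℝ (Fin n) →L[ℝ] EuclideanSpace ℝ (Fin n) :=
  mfderiv (𝓡 n) (𝓡 n) φ x

theorem Isom.differential_mul (φ ψ : Isom g) (x : M) :
    (φ * ψ).differential x = (φ.differential (ψ x)).comp (ψ.differential x) :=
  mfderiv_comp x (φ.mdifferentiable _) (ψ.mdifferentiable _)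

theorem Isom.differential_one (x : M) :
    (1 : Isom g).differential x = ContinuousLinearMap.id ℝ _ :=
  mfderiv_id

theorem Isom.differential_comp_inv (φ : Isom g) (x : M) :
    (φ.differential (φ⁻¹ x)).comp ((φ⁻¹).differential x) = ContinuousLinearMap.id ℝ _ := by
  rw [← Isom.differential_mul, mul_inv_cancel, Isom.differential_one]

theorem Isom.differential_inv_comp (φ : Isom g) (x : M) :
    ((φ⁻¹).differential x).comp (φ.differential (φ⁻¹ x)) = ContinuousLinearMap.id ℝ _ := by
  have h := Isom.differential_mul φ⁻¹ φ (φ⁻¹ x)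
  rw [inv_mul_cancel, Isom.differential_one, φ.apply_inv_self] at h
  exact h.symm

theorem Isom.inverse_differential_inv (φ : Isom g) (x : M) :
    ((φ⁻¹).differential x).inverse = φ.differential (φ⁻¹ x) :=
  ContinuousLinearMap.inverse_eq (φ.differential_inv_comp x) (φ.differential_comp_inv x)

theorem Ad_apply (φ : Isom g) (X : SmoothVectorField n M) (x : M) :
    (Ad φ X x : EuclideanSpace ℝ (Fin n)) = φ.differential (φ⁻¹ x) (X (φ⁻¹ x)) := by
  rw [← Isom.inverse_differential_inv]
  rfl

theorem Ad_apply_image (φ : Isom g) (X : SmoothVectorField n M) (x : M) :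
    (Ad φ X (φ x) : EuclideanSpace ℝ (Fin n)) = φ.differential x (X x) := by
  rw [Ad_apply]
  have aux : ∀ y z : M, y = z → φ.differential y (X y) = φ.differential z (X z) := by
    rintro y _ rfl; rfl
  exact aux _ _ (φ.inv_apply_self x)

theorem Ad_add (φ : Isom g) (X Y : SmoothVectorField n M) : Ad φ (X + Y) = Ad φ X + Ad φ Y := by
  ext1 x
  exact VectorField.mpullback_add_apply

theorem Ad_smul (φ : Isom g) (c : ℝ) (X : SmoothVectorField n M) : Ad φ (c • X) = c • Ad φ X := by
  ext1 x
  exact VectorField.mpullback_const_smul_apply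

theorem Ad_lie (φ : Isom g) (X Y : SmoothVectorField n M) : Ad φ ⁅X, Y⁆ = ⁅Ad φ X, Ad φ Y⁆ := by
  ext1 x
  refine VectorField.mpullback_mlieBracket (n := ∞) (X.mdifferentiableAt _) (Y.mdifferentiableAt _)
    φ⁻¹.toDiffeo.contMDiff.contMDiffAt ?_
  rw [minSmoothness_of_isRCLikeNormedField]
  exact WithTop.coe_le_coe.2 (le_top : (2 : ℕ∞) ≤ ⊤)

theorem Ad_one (X : SmoothVectorField n M) : Ad (1 : Isom g) X = X := by
  ext1 x
  have h : (Ad (1 : Isom g) X x : EuclideanSpace ℝ (Fin n)) = _ := Ad_apply_image 1 X x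
  rw [Isom.differential_one] at h
  exact h

theorem Ad_mul (φ ψ : Isom g) (X : SmoothVectorField n M) : Ad (φ * ψ) X = Ad φ (Ad ψ X) := by
  ext1 x
  have key : ∀ y, (Ad (φ * ψ) X (φ (ψ y)) : EuclideanSpace ℝ (Fin n)) =
      Ad φ (Ad ψ X) (φ (ψ y)) := by
    intro y
    refine (Ad_apply_image (φ * ψ) X y).trans ?_
    rw [Ad_apply_image, Ad_apply_image, Isom.differential_mul]
    rfl
  have h := key (ψ⁻¹ (φ⁻¹ x))
  rw [ψ.apply_inv_self, φ.apply_inv_self] at h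
  exact h

/-- `Ad φ` as an automorphism of the Lie algebra of vector fields. -/
def AdEquiv (φ : Isom g) : SmoothVectorField n M ≃ₗ⁅ℝ⁆ SmoothVectorField n M where
  toFun := Ad φ
  map_add' := Ad_add φ
  map_smul' c X := Ad_smul φ c X
  map_lie' {X Y} := Ad_lie φ X Y
  invFun := Ad φ⁻¹
  left_inv X := by rw [← Ad_mul, inv_mul_cancel, Ad_one]
  right_inv X := by rw [← Ad_mul, mul_inv_cancel, Ad_one]

theorem inner_Ad (φ : Isom g) (X Y : SmoothVectorField n M) (x : M) :
    g.inner (φ x) (Ad φ X (φ x)) (Ad φ Y (φ x)) = g.inner x (X x) (Y x) := by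
  have hX : Ad φ X (φ x) = mfderiv (𝓡 n) (𝓡 n) φ x (X x) := Ad_apply_image φ X x
  have hY : Ad φ Y (φ x) = mfderiv (𝓡 n) (𝓡 n) φ x (Y x) := Ad_apply_image φ Y x
  rw [hX, hY]
  exact φ.isometric x (X x) (Y x)

/-! ### One-parameter groups -/

theorem IsOneParameterGroup.conj {c : Multiplicative ℝ →* Isom g} {X : SmoothVectorField n M}
    (h : IsOneParameterGroup c X) (φ : Isom g) :
    IsOneParameterGroup ((MulAut.conj φ).toMonoidHom.comp c) (Ad φ X) := by
  refine ⟨?_, fun x t => ?_⟩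
  · have h1 : ContMDiff (𝓘(ℝ, ℝ).prod (𝓡 n)) (𝓘(ℝ, ℝ).prod (𝓡 n)) ∞
        (fun q : ℝ × M => (q.1, φ⁻¹ q.2)) :=
      contMDiff_fst.prodMk (φ⁻¹.toDiffeo.contMDiff.comp contMDiff_snd)
    exact φ.toDiffeo.contMDiff.comp (h.1.comp h1)
  · have h1 := h.2 (φ⁻¹ x) t
    have h2 : HasMFDerivAt (𝓡 n) (𝓡 n) φ (c (Multiplicative.ofAdd t) (φ⁻¹ x)) _ :=
      (φ.mdifferentiable _).hasMFDerivAt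
    have h3 := h2.comp t h1
    refine h3.congr_mfderiv ?_
    ext1
    let D := φ.differential (c (Multiplicative.ofAdd t) (φ⁻¹ x))
    let v : EuclideanSpace ℝ (Fin n) := X (c (Multiplicative.ofAdd t) (φ⁻¹ x))
    let w : EuclideanSpace ℝ (Fin n) := Ad φ X (φ (c (Multiplicative.ofAdd t) (φ⁻¹ x)))
    have h4 : w = D v := Ad_apply_image φ X (c (Multiplicative.ofAdd t) (φ⁻¹ x))
    change D ((1 : ℝ) • v) = (1 : ℝ) • w
    rw [h4, one_smul, one_smul]

/-- Orbits of both groups are integral curves of the same field from the same point, and these are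
unique on a Hausdorff manifold. This is how an identity of vector fields becomes an identity of
isometries. -/
theorem IsOneParameterGroup.unique [T2Space M] {c c' : Multiplicative ℝ →* Isom g}
    {X : SmoothVectorField n M} (h : IsOneParameterGroup c X) (h' : IsOneParameterGroup c' X) :
    c = c' := by
  refine MonoidHom.ext fun t => Isom.ext_apply fun x => ?_
  have : IsManifold (𝓡 n) 1 M := IsManifold.of_le (n := ∞) (by simp)
  have hX : ContMDiff (𝓡 n) ((𝓡 n).prod 𝓘(ℝ, EuclideanSpace ℝ (Fin n))) 1
      (fun x ↦ (⟨x, X x⟩ : TangentBundle (𝓡 n) M)) := X.contMDiff.of_le (by simp)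
  have h0 : c (Multiplicative.ofAdd 0) x = c' (Multiplicative.ofAdd 0) x := by
    rw [ofAdd_zero, map_one, map_one]
  have := isMIntegralCurve_Ioo_eq_of_contMDiff_boundaryless (t₀ := 0) hX (h.2 x) (h'.2 x) h0
  exact congrFun this (Multiplicative.toAdd t)

theorem Isom.continuous_mul_right (φ : Isom g) : Continuous (fun ψ : Isom g ↦ ψ * φ) :=
  continuous_induced_rng.2 <| by
    have h : Continuous (toContinuousMap : Isom g → C(M, M)) := continuous_induced_dom
    exact (ContinuousMap.continuous_precomp φ.toContinuousMap).comp h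

/-- Conjugation is continuous and fixes 1. Here φ is arbitrary, since the isometries given by weak
symmetry need not lie in the identity component. -/
theorem conj_mem_identityComponent (φ : Isom g) {ψ : Isom g} (h : ψ ∈ identityComponent g) :
    φ * ψ * φ⁻¹ ∈ identityComponent g := by
  have hc : Continuous (fun ψ : Isom g => φ * ψ * φ⁻¹) :=
    (Isom.continuous_mul_right φ⁻¹).comp (Isom.continuous_mul_left φ)
  have := hc.image_connectedComponent_subset 1 ⟨ψ, h, rfl⟩
  rwa [mul_one, mul_inv_cancel] at this

theorem Ad_mem_isomLieAlgebra (φ : Isom g) {X : SmoothVectorField n M}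
    (hX : X ∈ isomLieAlgebra g) : Ad φ X ∈ isomLieAlgebra g := by
  have h : isomLieAlgebra g ≤
      (isomLieAlgebra g).comap (AdEquiv φ : SmoothVectorField n M →ₗ⁅ℝ⁆ SmoothVectorField n M) := by
    refine LieSubalgebra.lieSpan_le.2 ?_
    rintro Y ⟨c, hc, hcm⟩
    exact LieSubalgebra.subset_lieSpan
      ⟨_, hc.conj φ, fun t => conj_mem_identityComponent φ (hcm t)⟩
  exact h hX

/-- `Ad φ` as an automorphism of `𝔤`. -/
def isomLieAlgebraAd (φ : Isom g) : isomLieAlgebra g ≃ₗ⁅ℝ⁆ isomLieAlgebra g where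
  toFun X := ⟨Ad φ X, Ad_mem_isomLieAlgebra φ X.2⟩
  map_add' X Y := Subtype.ext (Ad_add φ X Y)
  map_smul' c X := Subtype.ext (Ad_smul φ c X)
  map_lie' {X Y} := Subtype.ext (Ad_lie φ X Y)
  invFun X := ⟨Ad φ⁻¹ X, Ad_mem_isomLieAlgebra φ⁻¹ X.2⟩
  left_inv X := Subtype.ext ((AdEquiv φ).left_inv X.1)
  right_inv X := Subtype.ext ((AdEquiv φ).right_inv X.1)

theorem IsOneParameterGroup.hasDerivAt_mpullback {c : Multiplicative ℝ →* Isom g}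
    {X : SmoothVectorField n M} (h : IsOneParameterGroup c X) (Y : SmoothVectorField n M) (x : M) :
    HasDerivAt (fun t : ℝ => (Ad (c (Multiplicative.ofAdd t))⁻¹ Y x : EuclideanSpace ℝ (Fin n)))
      (⁅X, Y⁆ x : EuclideanSpace ℝ (Fin n)) 0 := by
  refine VectorField.hasDerivAt_mpullback_flow (φ := fun t x => c (Multiplicative.ofAdd t) x)
    h.1 (fun x => ?_) (fun x => h.2 x 0) x (Y.mdifferentiableAt x)
  rw [ofAdd_zero, map_one]
  rfl

/-- The group law c(s)⁻¹ = c(t)⁻¹ c(s - t)⁻¹ transports the formula at time 0 to time t. -/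
theorem IsOneParameterGroup.hasDerivAt_Ad {c : Multiplicative ℝ →* Isom g}
    {X : SmoothVectorField n M} (h : IsOneParameterGroup c X) (Y : SmoothVectorField n M) (x : M)
    (t : ℝ) :
    HasDerivAt (fun t : ℝ => (Ad (c (Multiplicative.ofAdd t))⁻¹ Y x : EuclideanSpace ℝ (Fin n)))
      (Ad (c (Multiplicative.ofAdd t))⁻¹ ⁅X, Y⁆ x : EuclideanSpace ℝ (Fin n)) t := by
  set ψ := (c (Multiplicative.ofAdd t))⁻¹ with hψ
  have h1 : HasDerivAt
      (fun s : ℝ => (Ad (c (Multiplicative.ofAdd s))⁻¹ Y (ψ⁻¹ x) : EuclideanSpace ℝ (Fin n)))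
      (⁅X, Y⁆ (ψ⁻¹ x) : EuclideanSpace ℝ (Fin n)) (t - t) := by
    rw [sub_self]; exact h.hasDerivAt_mpullback Y (ψ⁻¹ x)
  have h2 := ((ψ.differential (ψ⁻¹ x)).hasFDerivAt.comp_hasDerivAt t
    (h1.comp_sub_const t t))
  refine (h2.congr_deriv (Ad_apply ψ _ x).symm).congr_of_eventuallyEq (.of_forall fun s => ?_)
  have : (c (Multiplicative.ofAdd s))⁻¹ = ψ * (c (Multiplicative.ofAdd (s - t)))⁻¹ := by
    rw [hψ, ← mul_inv_rev, ← map_mul, ← ofAdd_add, sub_add_cancel]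
  simp only [this, Ad_mul]
  exact Ad_apply ψ _ x

end WeaklySymmetric

end

noncomputable section

namespace WeaklySymmetric

variable {n : ℕ} {M : Type*} [TopologicalSpace M] [ChartedSpace (EuclideanSpace ℝ (Fin n)) M]
  [IsManifold (𝓡 n) ∞ M] {g : PseudoRiemannianMetric n M}

/-! ### Killing fields -/

/-- The derivative of a function along a vector field. -/
def SmoothVectorField.deriv (X : SmoothVectorField n M) (f : M → ℝ) (x : M) : ℝ :=
  mvfderiv (𝓡 n) f x (X x)

/-- The product of a vector field by a smooth function. -/
def SmoothVectorField.funSMul (f : M → ℝ) (hf : ContMDiff (𝓡 n) 𝓘(ℝ, ℝ) ∞ f)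
    (X : SmoothVectorField n M) : SmoothVectorField n M :=
  ⟨f • ⇑X, hf.smul_section X.contMDiff⟩

theorem SmoothVectorField.lie_funSMul_apply {f : M → ℝ} (hf : ContMDiff (𝓡 n) 𝓘(ℝ, ℝ) ∞ f)
    (X Y : SmoothVectorField n M) (x : M) :
    ⁅X, Y.funSMul f hf⁆ x = X.deriv f x • Y x + f x • ⁅X, Y⁆ x :=
  VectorField.mlieBracket_smul_right (hf.mdifferentiable (by simp) x) (Y.mdifferentiableAt x)

theorem SmoothVectorField.lie_apply_eq_zero {X Y : SmoothVectorField n M} {x : M}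
    (hX : X x = 0) (hY : Y x = 0) : ⁅X, Y⁆ x = 0 :=
  VectorField.mlieBracketWithin_eq_zero_of_eq_zero hX hY

/-- Expanding the Jacobi identity for X, Y, fZ with [V, fZ] = V(f)Z + f[V, Z] gives the claim
multiplied by Z(x). A field Z with Z(x) ≠ 0 is found among X and Y themselves; if both vanish at x,
so do both sides. -/
theorem SmoothVectorField.deriv_lie (X Y : SmoothVectorField n M) {f : M → ℝ}
    (hf : ContMDiff (𝓡 n) 𝓘(ℝ, ℝ) ∞ f) (hXf : ContMDiff (𝓡 n) 𝓘(ℝ, ℝ) ∞ (X.deriv f))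
    (hYf : ContMDiff (𝓡 n) 𝓘(ℝ, ℝ) ∞ (Y.deriv f)) (x : M) :
    SmoothVectorField.deriv ⁅X, Y⁆ f x = X.deriv (Y.deriv f) x - Y.deriv (X.deriv f) x := by
  have key : ∀ Z : SmoothVectorField n M,
      SmoothVectorField.deriv ⁅X, Y⁆ f x • Z x =
        (X.deriv (Y.deriv f) x - Y.deriv (X.deriv f) x) • Z x := by
    intro Z
    have e : ∀ (V : SmoothVectorField n M) (hVf : ContMDiff (𝓡 n) 𝓘(ℝ, ℝ) ∞ (V.deriv f)),
        ⁅V, Z.funSMul f hf⁆ = Z.funSMul (V.deriv f) hVf + ⁅V, Z⁆.funSMul f hf := fun V hVf => by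
      ext1 y
      exact V.lie_funSMul_apply hf Z y
    have h := congrArg (fun V : SmoothVectorField n M => V x)
      (leibniz_lie X Y (Z.funSMul f hf))
    rw [e X hXf, e Y hYf, lie_add, lie_add] at h
    have hadd : ∀ V W : SmoothVectorField n M, (V + W) x = V x + W x := fun _ _ => rfl
    simp only [hadd, SmoothVectorField.lie_funSMul_apply] at h
    have hj : ⁅X, ⁅Y, Z⁆⁆ x = ⁅⁅X, Y⁆, Z⁆ x + ⁅Y, ⁅X, Z⁆⁆ x :=
      congrArg (fun V : SmoothVectorField n M => V x) (leibniz_lie X Y Z)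
    rw [hj, smul_add] at h
    rw [sub_smul, eq_sub_iff_add_eq]
    have h' := sub_eq_zero.2 h
    refine sub_eq_zero.1 (Eq.trans ?_ (neg_eq_zero.2 h'))
    abel
  by_cases hX : X x = 0
  · by_cases hY : Y x = 0
    · have h0 : ∀ (V : SmoothVectorField n M) (f : M → ℝ), V x = 0 → V.deriv f x = 0 := by
        intro V f hV
        rw [SmoothVectorField.deriv, hV, map_zero]
      rw [h0 _ _ (SmoothVectorField.lie_apply_eq_zero hX hY), h0 _ _ hX, h0 _ _ hY, sub_zero]
    · exact smul_left_injective ℝ hY (key Y)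
  · exact smul_left_injective ℝ hX (key X)

theorem SmoothVectorField.deriv_add (X : SmoothVectorField n M) {f f' : M → ℝ} {x : M}
    (hf : MDifferentiableAt (𝓡 n) 𝓘(ℝ, ℝ) f x) (hf' : MDifferentiableAt (𝓡 n) 𝓘(ℝ, ℝ) f' x) :
    X.deriv (fun y => f y + f' y) x = X.deriv f x + X.deriv f' x := by
  have h := mvfderiv_add hf hf'
  exact DFunLike.congr_fun h (X x)

variable (g) in
/-- The scalar product of two vector fields. -/
def innerFun (X Y : SmoothVectorField n M) (x : M) : ℝ := g.inner x (X x) (Y x)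

variable (g) in
theorem contMDiff_innerFun (X Y : SmoothVectorField n M) :
    ContMDiff (𝓡 n) 𝓘(ℝ, ℝ) ∞ (innerFun g X Y) := by
  have h : ContMDiff (𝓡 n) ((𝓡 n).prod 𝓘(ℝ, ℝ)) ∞
      (fun x => Bundle.TotalSpace.mk' ℝ (E := Bundle.Trivial M ℝ) x (g.inner x (X x) (Y x))) :=
    ContMDiff.clm_bundle_apply₂ (F₁ := EuclideanSpace ℝ (Fin n)) (F₂ := EuclideanSpace ℝ (Fin n))
      (F₃ := ℝ) g.contMDiff X.contMDiff Y.contMDiff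
  exact fun x => (Bundle.contMDiffAt_totalSpace.1 (h x)).2

variable (g) in
/-- The Lie algebra of Killing fields. -/
def killingAlgebra : LieSubalgebra ℝ (SmoothVectorField n M) where
  carrier := {W | ∀ X Y : SmoothVectorField n M,
    W.deriv (innerFun g X Y) = fun x => innerFun g ⁅W, X⁆ Y x + innerFun g X ⁅W, Y⁆ x}
  add_mem' {V W} hV hW X Y := by
    funext x
    have h1 := congrFun (hV X Y) x
    have h2 := congrFun (hW X Y) x
    have h3 : (V + W).deriv (innerFun g X Y) x
        = V.deriv (innerFun g X Y) x + W.deriv (innerFun g X Y) x :=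
      map_add (mvfderiv (𝓡 n) (innerFun g X Y) x) (V x) (W x)
    rw [h3, h1, h2, add_lie, add_lie]
    simp only [innerFun, ContMDiffSection.coe_add, Pi.add_apply, map_add, add_apply]
    ring
  zero_mem' X Y := by
    funext x
    have h3 : (0 : SmoothVectorField n M).deriv (innerFun g X Y) x = 0 :=
      map_zero (mvfderiv (𝓡 n) (innerFun g X Y) x)
    rw [h3, zero_lie, zero_lie]
    simp [innerFun]
  smul_mem' c W hW X Y := by
    funext x
    have h1 := congrFun (hW X Y) x
    have h3 : (c • W).deriv (innerFun g X Y) x = c * W.deriv (innerFun g X Y) x :=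
      map_smul (mvfderiv (𝓡 n) (innerFun g X Y) x) c (W x)
    rw [h3, h1, smul_lie, smul_lie]
    simp only [innerFun, ContMDiffSection.coe_smul, Pi.smul_apply, map_smul, smul_apply,
      smul_eq_mul]
    ring
  lie_mem' {V W} hV hW X Y := by
    funext x
    have hd : ∀ X Y : SmoothVectorField n M,
        MDifferentiableAt (𝓡 n) 𝓘(ℝ, ℝ) (innerFun g X Y) x := fun X Y =>
      (contMDiff_innerFun g X Y).mdifferentiable (by simp) x
    -- The Killing equation itself exhibits U⟨X, Y⟩ as a sum of scalar products of smooth fields,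
    -- which gives the smoothness that `deriv_lie` asks for.
    have hs : ∀ U : SmoothVectorField n M, U ∈ {W : SmoothVectorField n M | ∀ X Y,
        W.deriv (innerFun g X Y) = fun x => innerFun g ⁅W, X⁆ Y x + innerFun g X ⁅W, Y⁆ x} →
        ContMDiff (𝓡 n) 𝓘(ℝ, ℝ) ∞ (U.deriv (innerFun g X Y)) := fun U hU => by
      rw [hU X Y]
      exact (contMDiff_innerFun g _ _).add (contMDiff_innerFun g _ _)
    rw [SmoothVectorField.deriv_lie V W (contMDiff_innerFun g X Y) (hs V hV) (hs W hW) x,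
      hV X Y, hW X Y, SmoothVectorField.deriv_add _ (hd _ _) (hd _ _),
      SmoothVectorField.deriv_add _ (hd _ _) (hd _ _), hV, hV, hW, hW, lie_lie, lie_lie]
    simp only [innerFun, ContMDiffSection.coe_sub, Pi.sub_apply, map_sub, sub_apply]
    ring

/-- Differentiate t ↦ ⟨X, Y⟩ at c(t)x in two ways: by the chain rule, and after moving both fields
back to x by the isometry c(t)⁻¹, where the Lie derivative formula applies. -/
theorem IsOneParameterGroup.mem_killingAlgebra {c : Multiplicative ℝ →* Isom g}
    {W : SmoothVectorField n M} (h : IsOneParameterGroup c W) : W ∈ killingAlgebra g := by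
  intro X Y
  funext x
  have h0 : c (Multiplicative.ofAdd 0) x = x := by rw [ofAdd_zero, map_one]; rfl
  let B : EuclideanSpace ℝ (Fin n) →L[ℝ] EuclideanSpace ℝ (Fin n) →L[ℝ] ℝ := g.inner x
  have h1 : HasDerivAt (fun t : ℝ => innerFun g X Y (c (Multiplicative.ofAdd t) x))
      (innerFun g ⁅W, X⁆ Y x + innerFun g X ⁅W, Y⁆ x) 0 := by
    have hX := h.hasDerivAt_mpullback X x
    have hY := h.hasDerivAt_mpullback Y x
    have hB := (B.hasFDerivAt.comp_hasDerivAt (0 : ℝ) hX).clm_apply hY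
    have e : ∀ t : ℝ, innerFun g X Y (c (Multiplicative.ofAdd t) x) =
        B (Ad (c (Multiplicative.ofAdd t))⁻¹ X x) (Ad (c (Multiplicative.ofAdd t))⁻¹ Y x) := by
      intro t
      have := inner_Ad (c (Multiplicative.ofAdd t))⁻¹ X Y (c (Multiplicative.ofAdd t) x)
      rw [Isom.inv_apply_self] at this
      exact this.symm
    have e0 : ∀ Z : SmoothVectorField n M, Ad (c (Multiplicative.ofAdd 0))⁻¹ Z = Z := fun Z => by
      rw [ofAdd_zero, map_one, inv_one, Ad_one]
    refine (hB.congr_deriv ?_).congr_of_eventuallyEq (.of_forall e)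
    simp only [Function.comp, e0]
    rfl
  have h2 : HasDerivAt (fun t : ℝ => innerFun g X Y (c (Multiplicative.ofAdd t) x))
      (W.deriv (innerFun g X Y) x) 0 := by
    have hf : HasMFDerivAt (𝓡 n) 𝓘(ℝ, ℝ) (innerFun g X Y) (c (Multiplicative.ofAdd 0) x)
        (mfderiv (𝓡 n) 𝓘(ℝ, ℝ) (innerFun g X Y) (c (Multiplicative.ofAdd 0) x)) :=
      ((contMDiff_innerFun g X Y).mdifferentiable (by simp) _).hasMFDerivAt
    let D : M → EuclideanSpace ℝ (Fin n) →L[ℝ] ℝ :=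
      fun y => mfderiv (𝓡 n) 𝓘(ℝ, ℝ) (innerFun g X Y) y
    let w : M → EuclideanSpace ℝ (Fin n) := fun y => W y
    have h3 : HasFDerivAt (fun t : ℝ => innerFun g X Y (c (Multiplicative.ofAdd t) x))
        ((D (c (Multiplicative.ofAdd 0) x)).comp
          ((1 : ℝ →L[ℝ] ℝ).smulRight (w (c (Multiplicative.ofAdd 0) x)))) 0 := by
      have h4 := HasMFDerivAt.comp (f := fun t : ℝ => c (Multiplicative.ofAdd t) x) (0 : ℝ) hf
        (h.2 x 0)
      exact h4.hasFDerivAt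
    refine h3.hasDerivAt.congr_deriv ?_
    rw [h0]
    change D x ((1 : ℝ) • w x) = D x (w x)
    rw [one_smul]
  exact h2.unique h1

/-- As 𝔤 is defined as a generated subalgebra, what matters is that the Killing equation is stable
under brackets. -/
theorem isomLieAlgebra_le_killingAlgebra : isomLieAlgebra g ≤ killingAlgebra g :=
  LieSubalgebra.lieSpan_le.2 fun _ ⟨_, hc, _⟩ => hc.mem_killingAlgebra

/-- A Killing field vanishing at `p` acts on the tangent space at `p` by a skew map. -/
theorem inner_lie_eq_zero {W : SmoothVectorField n M} (hW : W ∈ killingAlgebra g) {p : M}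
    (hp : W p = 0) (X : SmoothVectorField n M) : g.inner p (⁅W, X⁆ p) (X p) = 0 := by
  have h : W.deriv (innerFun g X X) p = innerFun g ⁅W, X⁆ X p + innerFun g X ⁅W, X⁆ p :=
    congrFun (hW X X) p
  rw [SmoothVectorField.deriv, hp, map_zero, innerFun, innerFun, g.symm p (X p)] at h
  linarith

end WeaklySymmetric

end

noncomputable section

/-! ### From commuting relations on generators to nilpotency class two -/

/-- A group generated by a set whose commutators commute with the generators is nilpotent of
class at most two. -/
theorem Subgroup.isNilpotent_closure_of_commutator_comm {G : Type*} [Group G] (S : Set G)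
    (h : ∀ a ∈ S, ∀ b ∈ S, ∀ c ∈ S, (a * b * a⁻¹ * b⁻¹) * c = c * (a * b * a⁻¹ * b⁻¹)) :
    Group.IsNilpotent (Subgroup.closure S) ∧ Group.nilpotencyClass (Subgroup.closure S) ≤ 2 := by
  set N := Subgroup.closure S with hN
  let T : Set N := (↑) ⁻¹' S
  have hT : Subgroup.closure T = ⊤ := Subgroup.closure_closure_coe_preimage
  let q : N →* N ⧸ Subgroup.center N := QuotientGroup.mk' _
  have hcenter : ∀ a ∈ T, ∀ b ∈ T, a * b * a⁻¹ * b⁻¹ ∈ Subgroup.center N := by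
    intro a ha b hb
    have h1 : Subgroup.closure T ≤ Subgroup.centralizer {a * b * a⁻¹ * b⁻¹} := by
      rw [Subgroup.closure_le]
      intro c hc
      rw [SetLike.mem_coe, Subgroup.mem_centralizer_singleton_iff]
      exact Subtype.ext (h a ha b hb c hc).symm
    rw [Subgroup.mem_center_iff]
    intro c
    exact Subgroup.mem_centralizer_singleton_iff.1 (h1 (hT ▸ Subgroup.mem_top c))
  have hgen : Subgroup.closure (q '' T) = ⊤ := by
    rw [← MonoidHom.map_closure, hT, ← MonoidHom.range_eq_map]
    exact MonoidHom.range_eq_top.2 (QuotientGroup.mk'_surjective _)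
  have hcomm : ∀ x ∈ q '' T, ∀ y ∈ q '' T, x * y = y * x := by
    rintro _ ⟨a, ha, rfl⟩ _ ⟨b, hb, rfl⟩
    have h1 : q (a * b * a⁻¹ * b⁻¹) = 1 := (QuotientGroup.eq_one_iff _).2 (hcenter a ha b hb)
    simp only [map_mul, map_inv] at h1
    rw [mul_inv_eq_one, mul_inv_eq_iff_eq_mul] at h1
    exact h1
  have hab : ∀ x y : N ⧸ Subgroup.center N, x * y = y * x := by
    have h1 := Subgroup.isMulCommutative_closure hcomm
    intro x y
    have hx : x ∈ Subgroup.closure (q '' T) := hgen ▸ Subgroup.mem_top x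
    have hy : y ∈ Subgroup.closure (q '' T) := hgen ▸ Subgroup.mem_top y
    exact congrArg Subtype.val (h1.is_comm.comm ⟨x, hx⟩ ⟨y, hy⟩)
  have hab' : IsMulCommutative (N ⧸ Subgroup.center N) := ⟨⟨hab⟩⟩
  have hker : q.ker ≤ Subgroup.center N := (QuotientGroup.ker_mk' _).le
  have hnil : Group.IsNilpotent (N ⧸ Subgroup.center N) :=
    @CommGroup.isNilpotent _ { (inferInstance : Group (N ⧸ Subgroup.center N)) with mul_comm := hab }
  exact ⟨Subgroup.isNilpotent_of_ker_le_center q hker,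
    (Group.nilpotencyClass_le_of_ker_le_center q hker).trans
      (Nat.succ_le_succ (Group.IsNilpotent.nilpotencyClass_le_one_iff.2 hab'))⟩

namespace WeaklySymmetric

variable {n : ℕ} {M : Type*} [TopologicalSpace M] [ChartedSpace (EuclideanSpace ℝ (Fin n)) M]
  [IsManifold (𝓡 n) ∞ M] {g : PseudoRiemannianMetric n M}

/-! ### The isotropy argument -/

/-- The isometries fixing `p` act on `𝔫`, and the vectors of `𝔫` orthogonal to `[𝔫, 𝔫]` at
`p` have no diagonal on `[𝔫, 𝔫]`. -/
theorem inner_lie_eq_zero_of_orthogonal (hM : IsWeaklySymmetric g) (p : M)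
    (hdef : ∀ X ∈ ⁅nilradicalAlgebra g, nilradicalAlgebra g⁆,
      g.inner p (X.1 p) (X.1 p) = 0 → X = 0)
    {X : isomLieAlgebra g} (hX : X ∈ ⁅nilradicalAlgebra g, nilradicalAlgebra g⁆)
    {Y : isomLieAlgebra g}
    (hYo : ∀ Z ∈ ⁅nilradicalAlgebra g, nilradicalAlgebra g⁆, g.inner p (Y.1 p) (Z.1 p) = 0) :
    g.inner p (⁅X, Y⁆.1 p) (X.1 p) = 0 := by
  -- Weak symmetry only reverses nonzero vectors. In the excluded case X_p = -Y_p is orthogonal to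
  -- itself, so X = 0.
  by_cases hne : X.1 p + Y.1 p = 0
  · have h0 : X = 0 := by
      refine hdef X hX ?_
      have hXY : X.1 p = -Y.1 p := eq_neg_of_add_eq_zero_left hne
      have h := hYo X hX
      calc g.inner p (X.1 p) (X.1 p) = g.inner p (-Y.1 p) (X.1 p) := by rw [← hXY]
        _ = 0 := by rw [map_neg, neg_apply, h, neg_zero]
    subst h0
    exact map_zero (g.inner p _)
  obtain ⟨φ, hφ⟩ := hM p (X.1 p + Y.1 p) hne
  have hp : φ p = p := congrArg Bundle.TotalSpace.proj hφ
  have hφ' : φ.differential p (X.1 p + Y.1 p : EuclideanSpace ℝ (Fin n)) =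
      (-(X.1 p + Y.1 p) : EuclideanSpace ℝ (Fin n)) := by
    have h := hφ
    rw [tangentMap, Bundle.TotalSpace.mk.injEq] at h
    exact eq_of_heq h.2
  let e := isomLieAlgebraAd φ
  have hinner : ∀ V W : isomLieAlgebra g,
      g.inner p ((e V).1 p) ((e W).1 p) = g.inner p (V.1 p) (W.1 p) := by
    intro V W
    have h := inner_Ad φ V.1 W.1 p
    rw [hp] at h
    exact h
  have hevadd : ∀ V W : isomLieAlgebra g, (V + W).1 p = V.1 p + W.1 p := fun _ _ => rfl
  have hevneg : ∀ V : isomLieAlgebra g, (-V).1 p = -V.1 p := fun _ => rfl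
  have hsum : (e X + X).1 p + (e Y + Y).1 p = 0 := by
    have h1 := Ad_apply_image φ (X.1 + Y.1) p
    have h2 : (Ad φ (X.1 + Y.1) (φ p) : EuclideanSpace ℝ (Fin n)) = -(X.1 p + Y.1 p) :=
      h1.trans hφ'
    rw [hp, Ad_add] at h2
    have h3 : (e X).1 p + (e Y).1 p = -(X.1 p + Y.1 p) := h2
    rw [hevadd, hevadd]
    calc _ = ((e X).1 p + (e Y).1 p) + (X.1 p + Y.1 p) := by abel
      _ = 0 := by rw [h3, neg_add_cancel]
  have hXz : e X + X ∈ ⁅nilradicalAlgebra g, nilradicalAlgebra g⁆ :=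
    add_mem (lie_lieNilradical_map_le e hX) hX
  have hYo' : ∀ Z ∈ ⁅nilradicalAlgebra g, nilradicalAlgebra g⁆,
      g.inner p ((e Y + Y).1 p) (Z.1 p) = 0 := by
    intro Z hZ
    have h1 : g.inner p ((e Y).1 p) (Z.1 p) = 0 := by
      have h2 := hinner Y (e.symm Z)
      rw [LieEquiv.apply_symm_apply] at h2
      rw [h2]
      exact hYo _ (lie_lieNilradical_map_le e.symm hZ)
    rw [hevadd, map_add, add_apply, h1, hYo Z hZ, add_zero]
  -- At p this vector is minus (e Y + Y)_p, which is orthogonal to [𝔫, 𝔫]; being in [𝔫, 𝔫] itself,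
  -- it is null, and definiteness applies.
  have hU : e X + X = 0 := by
    refine hdef _ hXz ?_
    have h1 : (e X + X).1 p = -(e Y + Y).1 p := eq_neg_of_add_eq_zero_left hsum
    calc _ = g.inner p (-(e Y + Y).1 p) ((e X + X).1 p) := by rw [← h1]
      _ = 0 := by rw [map_neg, neg_apply, hYo' _ hXz, neg_zero]
  have hV : (e Y + Y).1 p = 0 := by
    rw [hU] at hsum
    have h0 : (0 : isomLieAlgebra g).1 p = 0 := rfl
    rwa [h0, zero_add] at hsum
  have hkill := inner_lie_eq_zero (isomLieAlgebra_le_killingAlgebra (e Y + Y).2) hV X.1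
  have heX : e X = -X := eq_neg_of_add_eq_zero_left hU
  have heXY : e ⁅X, Y⁆ = ⁅X, Y⁆ + ⁅e Y + Y, X⁆ := by
    rw [LieEquiv.map_lie, heX, neg_lie, lie_skew, add_lie, ← lie_skew Y X]
    abel
  -- With W = e Y + Y this reads -⟨[X,Y] + [W,X], X⟩ = ⟨[X,Y], X⟩ at p, and the W term is zero
  -- because W is Killing and vanishes at p.
  have h := hinner ⁅X, Y⁆ X
  have hkill' : g.inner p (⁅e Y + Y, X⁆.1 p) (X.1 p) = 0 := hkill
  rw [heXY, heX, hevneg, hevadd, map_neg, map_add, add_apply, hkill', add_zero] at h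
  linarith

theorem lie_lie_nilradicalAlgebra_eq_bot (hM : IsWeaklySymmetric g) (p : M)
    (hdef :
      (∀ X ∈ ⁅nilradicalAlgebra g, nilradicalAlgebra g⁆,
        X ≠ 0 → 0 < g.inner p (X.1 p) (X.1 p)) ∨
      (∀ X ∈ ⁅nilradicalAlgebra g, nilradicalAlgebra g⁆,
        X ≠ 0 → g.inner p (X.1 p) (X.1 p) < 0)) :
    ⁅nilradicalAlgebra g, ⁅nilradicalAlgebra g, nilradicalAlgebra g⁆⁆ = ⊥ := by
  have hdef0 : ∀ X ∈ ⁅nilradicalAlgebra g, nilradicalAlgebra g⁆,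
      g.inner p (X.1 p) (X.1 p) = 0 → X = 0 := by
    intro X hX h
    by_contra hne
    rcases hdef with hd | hd
    · exact (hd X hX hne).ne' h
    · exact (hd X hX hne).ne h
  let ev : isomLieAlgebra g →ₗ[ℝ] EuclideanSpace ℝ (Fin n) :=
    { toFun := fun X => X.1 p
      map_add' := fun _ _ => rfl
      map_smul' := fun _ _ => rfl }
  let B : EuclideanSpace ℝ (Fin n) →ₗ[ℝ] EuclideanSpace ℝ (Fin n) →ₗ[ℝ] ℝ :=
    LinearMap.mk₂ ℝ (fun v w => g.inner p v w)
      (fun v v' w => by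
        have h : g.inner p (v + v') = g.inner p v + g.inner p v' := map_add (g.inner p) v v'
        exact DFunLike.congr_fun h w)
      (fun c v w => by
        have h : g.inner p (c • v) = c • g.inner p v := map_smul (g.inner p) c v
        exact DFunLike.congr_fun h w)
      (fun v w w' => map_add (g.inner p v) w w') (fun c v w => map_smul (g.inner p v) c w)
  rcases hdef with hd | hd
  · refine lie_lie_lieNilradical_eq_bot ev B (fun v w => g.symm p v w) hd ?_
    intro X hX Y _ hYo
    exact inner_lie_eq_zero_of_orthogonal hM p hdef0 hX hYo
  -- The negative definite case follows by changing the sign of the form, which preserves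
  -- orthogonality and vanishing diagonals.
  · refine lie_lie_lieNilradical_eq_bot ev (-B) (fun v w => congrArg Neg.neg (g.symm p v w))
      (fun X hX hne => neg_pos.2 (hd X hX hne)) ?_
    intro X hX Y _ hYo
    exact neg_eq_zero.2 (inner_lie_eq_zero_of_orthogonal hM p hdef0 hX
      fun Z hZ => neg_eq_zero.1 (hYo Z hZ))

/-! ### The nilradical of the group -/

/-- The exponential series of `ad X` stops after the linear term on `Y` when
`[X, [X, Y]] = 0`. -/
theorem IsOneParameterGroup.Ad_inv_eq {c : Multiplicative ℝ →* Isom g}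
    {X Y : SmoothVectorField n M} (h : IsOneParameterGroup c X) (hXY : ⁅X, ⁅X, Y⁆⁆ = 0) (t : ℝ) :
    Ad (c (Multiplicative.ofAdd t))⁻¹ Y = Y + t • ⁅X, Y⁆ := by
  ext1 x
  have h0 : ∀ Z : SmoothVectorField n M, Ad (c (Multiplicative.ofAdd 0))⁻¹ Z = Z := fun Z => by
    rw [ofAdd_zero, map_one, inv_one, Ad_one]
  have hA0 : ∀ φ : Isom g, Ad φ (0 : SmoothVectorField n M) = 0 := fun φ => (AdEquiv φ).map_zero
  let k : ℝ → EuclideanSpace ℝ (Fin n) := fun t => Ad (c (Multiplicative.ofAdd t))⁻¹ ⁅X, Y⁆ x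
  have hk : ∀ t, HasDerivAt k 0 t := fun t => by
    have h1 := h.hasDerivAt_Ad ⁅X, Y⁆ x t
    rw [hXY, hA0] at h1
    exact h1
  have hkc : ∀ t, k t = k 0 := fun t =>
    is_const_of_deriv_eq_zero (fun s => (hk s).differentiableAt) (fun s => (hk s).deriv) t 0
  -- The derivative of f is k, which is constant because [X, [X, Y]] = 0; hence f is affine in t.
  let f : ℝ → EuclideanSpace ℝ (Fin n) := fun t => Ad (c (Multiplicative.ofAdd t))⁻¹ Y x
  have hf : ∀ t, HasDerivAt (fun s => f s - s • k 0) 0 t := fun t => by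
    have h1 : HasDerivAt f (k t) t := h.hasDerivAt_Ad Y x t
    have h2 : HasDerivAt (fun s : ℝ => s • k 0) ((1 : ℝ) • k 0) t :=
      (hasDerivAt_id t).smul_const (k 0)
    refine (h1.sub h2).congr_deriv ?_
    rw [hkc, one_smul, sub_self]
  have hfc := is_const_of_deriv_eq_zero (fun s => (hf s).differentiableAt)
    (fun s => (hf s).deriv) t 0
  have hk0 : k 0 = ⁅X, Y⁆ x := congrArg (fun Z : SmoothVectorField n M => Z x) (h0 ⁅X, Y⁆)
  have hf0 : f 0 = Y x := congrArg (fun Z : SmoothVectorField n M => Z x) (h0 Y)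
  have hfin : f t = f 0 + t • k 0 := by
    simp only [zero_smul, sub_zero] at hfc
    rw [← hfc, sub_add_cancel]
  rw [hk0, hf0] at hfin
  exact hfin

theorem IsOneParameterGroup.Ad_eq {c : Multiplicative ℝ →* Isom g}
    {X Y : SmoothVectorField n M} (h : IsOneParameterGroup c X) (hXY : ⁅X, ⁅X, Y⁆⁆ = 0) (t : ℝ) :
    Ad (c (Multiplicative.ofAdd t)) Y = Y - t • ⁅X, Y⁆ := by
  have := h.Ad_inv_eq hXY (-t)
  rwa [ofAdd_neg, map_inv, inv_inv, neg_smul, ← sub_eq_add_neg] at this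

/-- For φ = exp X and ψ = exp Y, the linear terms [X, Z] and [Y, Z] appear and cancel in turn, so
the commutator of φ and ψ fixes Z. Conjugating the one-parameter group of Z by it leaves the
velocity field unchanged, hence the group itself, so the commutator commutes with exp Z. No
Baker–Campbell–Hausdorff formula is involved. -/
theorem nilpotencyClass_nilradicalGroup_le_two [T2Space M]
    (h : ⁅nilradicalAlgebra g, ⁅nilradicalAlgebra g, nilradicalAlgebra g⁆⁆ = ⊥) :
    Group.IsNilpotent (nilradicalGroup g) ∧ Group.nilpotencyClass (nilradicalGroup g) ≤ 2 := by
  have h3 : ∀ X ∈ nilradicalAlgebra g, ∀ Y ∈ nilradicalAlgebra g, ∀ Z ∈ nilradicalAlgebra g,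
      ⁅X.1, ⁅Y.1, Z.1⁆⁆ = 0 := by
    intro X hX Y hY Z hZ
    have h1 : ⁅X, ⁅Y, Z⁆⁆ ∈ (⊥ : LieIdeal ℝ (isomLieAlgebra g)) := by
      rw [← h]
      exact LieSubmodule.lie_mem_lie hX (LieSubmodule.lie_mem_lie hY hZ)
    exact congrArg Subtype.val ((LieSubmodule.mem_bot _).1 h1)
  refine Subgroup.isNilpotent_closure_of_commutator_comm _ ?_
  rintro _ ⟨_, ⟨X, hX, rfl⟩, a, ha, -, rfl⟩ _ ⟨_, ⟨Y, hY, rfl⟩, b, hb, -, rfl⟩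
    _ ⟨_, ⟨Z, hZ, rfl⟩, c, hc, -, rfl⟩
  set φ := a (Multiplicative.ofAdd 1) with hφ
  set ψ := b (Multiplicative.ofAdd 1) with hψ
  have e1 : Ad ψ⁻¹ Z.1 = Z.1 + ⁅Y.1, Z.1⁆ := by
    rw [hψ, hb.Ad_inv_eq (h3 Y hY Y hY Z hZ), one_smul]
  have e2 : Ad φ⁻¹ (Z.1 + ⁅Y.1, Z.1⁆) = Z.1 + ⁅X.1, Z.1⁆ + ⁅Y.1, Z.1⁆ := by
    rw [Ad_add, hφ, ha.Ad_inv_eq (h3 X hX X hX Z hZ), ha.Ad_inv_eq, h3 X hX Y hY Z hZ, one_smul,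
      one_smul, add_zero]
    rw [h3 X hX Y hY Z hZ, lie_zero]
  have e3 : Ad ψ (Z.1 + ⁅X.1, Z.1⁆ + ⁅Y.1, Z.1⁆) = Z.1 + ⁅X.1, Z.1⁆ := by
    rw [Ad_add, Ad_add, hψ, hb.Ad_eq (h3 Y hY Y hY Z hZ), hb.Ad_eq, hb.Ad_eq,
      h3 Y hY X hX Z hZ, h3 Y hY Y hY Z hZ, one_smul, smul_zero, sub_zero, sub_zero]
    · abel
    · rw [h3 Y hY Y hY Z hZ, lie_zero]
    · rw [h3 Y hY X hX Z hZ, lie_zero]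
  have e4 : Ad φ (Z.1 + ⁅X.1, Z.1⁆) = Z.1 := by
    rw [Ad_add, hφ, ha.Ad_eq (h3 X hX X hX Z hZ), ha.Ad_eq, h3 X hX X hX Z hZ, one_smul,
      smul_zero, sub_zero, sub_add_cancel]
    rw [h3 X hX X hX Z hZ, lie_zero]
  have hw : Ad (φ * ψ * φ⁻¹ * ψ⁻¹) Z.1 = Z.1 := by
    rw [Ad_mul, Ad_mul, Ad_mul, e1, e2, e3, e4]
  have hconj := hc.conj (φ * ψ * φ⁻¹ * ψ⁻¹)
  rw [hw] at hconj
  have hcc := DFunLike.congr_fun (hconj.unique hc) (Multiplicative.ofAdd 1)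
  exact mul_inv_eq_iff_eq_mul.1 hcc

end WeaklySymmetric

end

theorem theorem4p12 {n : ℕ} {M : Type*} [TopologicalSpace M]
    [ChartedSpace (EuclideanSpace ℝ (Fin n)) M] [IsManifold (𝓡 n) ∞ M]
    [T2Space M] [SecondCountableTopology M] [ConnectedSpace M]
    (g : WeaklySymmetric.PseudoRiemannianMetric n M)
    (hM : WeaklySymmetric.IsWeaklySymmetric g)
    (p : M) (m : Submodule ℝ (WeaklySymmetric.SmoothVectorField n M))
    (hm : WeaklySymmetric.IsReductiveDecomposition g p m)
    (hn : ∀ X ∈ WeaklySymmetric.nilradicalAlgebra g, (X : WeaklySymmetric.SmoothVectorField n M) ∈ m)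
    (hdef :
      (∀ X ∈ ⁅WeaklySymmetric.nilradicalAlgebra g, WeaklySymmetric.nilradicalAlgebra g⁆,
        X ≠ 0 → 0 < g.inner p (X.1 p) (X.1 p)) ∨
      (∀ X ∈ ⁅WeaklySymmetric.nilradicalAlgebra g, WeaklySymmetric.nilradicalAlgebra g⁆,
        X ≠ 0 → g.inner p (X.1 p) (X.1 p) < 0)) :
    Group.IsNilpotent (WeaklySymmetric.nilradicalGroup g) ∧
      Group.nilpotencyClass (WeaklySymmetric.nilradicalGroup g) ≤ 2 := by
  exact WeaklySymmetric.nilpotencyClass_nilradicalGroup_le_two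
    (WeaklySymmetric.lie_lie_nilradicalAlgebra_eq_bot hM p hdef)
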